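/- Let $d\ge 1$, let $m\ge 0$ be an integer, and let $\{X_i\}_{i\ge1}$, $\{Y_i\}_{i\ge1}$ be sequences of random vectors in $\mathbb R^d$ on a common probability space such that the $2d$-dimensional sequence $\{(X_i,Y_i)\}_{i\ge1}$ is strictly stationary and $m$-dependent, i.e. $\{(X_i,Y_i)\}_{i\le b}$ and $\{(X_i,Y_i)\}_{b+k\le i\le b+k+l}$ are independent for all $b,k,l\ge1$ with $k>m$. Suppose that $X_1$ and $Y_1$ have densities $p_X,p_Y$ and that $p_X,p_Y\in L_3(\mathbb R^d)$. Let $\epsilon=\epsilon(n)>0$ with $\epsilon\to0$ as $n\to\infty$, and let $b_\epsilon(d)$ be the volume of a Euclidean ball of radius $\epsilon$ in $\mathbb R^d$. For $(k,l)\in\{(2,0),(1,1),(0,2)\}$ put $q_{k,l}=\int_{\mathbb R^d}p_X(x)^kp_Y(x)^l\,dx$ and $\tilde Q_{k,l,n}=Q_{k,l,n}/b_\epsilon(d)$, where $$Q_{2,0,n}=\binom n2^{-1}\sum_{1\le i<j\le n}\mathbf 1\{|X_i-X_j|\le\epsilon\},\qquad Q_{1,1,n}=\frac1{n^2}\sum_{i=1}^n\sum_{j=1}^n\mathbf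 1\{|X_i-Y_j|\le\epsilon\},$$ and $Q_{0,2,n}$ is defined as $Q_{2,0,n}$ with $Y$ in place of $X$. With $g(x,y)=\tfrac12(p_Y(x)+p_X(y))$ let $$\sigma_{2,0}^2=\mathrm{Var}(p_X(X_1))+2\sum_{h=1}^m\mathrm{Cov}(p_X(X_1),p_X(X_{1+h})),$$ $$\sigma_{1,1}^2=\mathrm{Var}(g(X_1,Y_1))+2\sum_{h=1}^m\mathrm{Cov}(g(X_1,Y_1),g(X_{1+h},Y_{1+h})),$$ and let $\sigma_{0,2}^2$ be defined as $\sigma_{2,0}^2$ with $Y$ in place of $X$. For $0<\alpha\le1$ and $K>0$ let $H_2^{(\alpha)}(K)$ be the set of $p\in L_2(\mathbb R^d)$ with $\big(\int_{\mathbb R^d}(p(x-h)-p(x))^2dx\big)^{1/2}\le K|h|^\alpha$ for all $|h|\le1$. Then, for each such $(k,l)$: (i) If $n\epsilon^d\to\infty$, then $\mathrm E(\tilde Q_{k,l,n}-q_{k,l})^2\to0$ as $n\to\infty$. (ii) If $p_X,p_Y\in H_2^{(\alpha)}(K)$ for some $0<\alpha\le 1$ with $\alpha\le d/2$ and some $K>0$,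 and $\epsilon\sim c\,n^{-1/(2\alpha+d)}$ for some $c>0$, then $\mathrm E(\tilde Q_{k,l,n}-q_{k,l})^2=O(n^{-4\alpha/(2\alpha+d)})$ as $n\to\infty$. (iii) If $d=1$, $p_X,p_Y\in H_2^{(\alpha)}(K)$ for some $1/2<\alpha\le1$ and some $K>0$, and $\epsilon\sim L(n)n^{-1/2}$ for a slowly varying function $L$ with $L(n)\to\infty$, then $\mathrm E(\tilde Q_{k,l,n}-q_{k,l})^2=4\sigma_{k,l}^2n^{-1}+o(n^{-1})$ as $n\to\infty$. -/

import Mathlib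

open MeasureTheory ProbabilityTheory Filter Topology Asymptotics

noncomputable section

namespace QuadDensity

/-- The space `R^d` with the Euclidean norm and Lebesgue measure `volume`. -/
abbrev Rd (d : ℕ) : Type := EuclideanSpace ℝ (Fin d)

/-! Sequences are indexed by `ℕ` starting at `0`: the `i`-th term (`i = 1, 2, …` in the usual
numbering) of a sequence `W` is `W (i - 1)`, and the first `n` terms are `W i` for `i < n`. -/

/-- Strict stationarity: every finite block of consecutive terms has the same law as the
block shifted by `h`. -/
def StrictlyStationary {Ω S : Type*} [MeasurableSpace Ω] [MeasurableSpace S]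
    (μ : Measure Ω) (W : ℕ → Ω → S) : Prop :=
  ∀ r h : ℕ, IdentDistrib (fun ω (i : Fin r) => W i ω) (fun ω (i : Fin r) => W (i + h) ω) μ μ

/-- `m`-dependence: the (nonempty) initial block of terms with indices `0, …, b` is independent
of the block with indices `b + k, …, b + k + l` as soon as `k > m`. -/
def MDependent {Ω S : Type*} [MeasurableSpace Ω] [MeasurableSpace S]
    (μ : Measure Ω) (m : ℕ) (W : ℕ → Ω → S) : Prop :=
  ∀ b k l : ℕ, m < k →
    IndepFun (fun ω (i : Fin (b + 1)) => W i ω) (fun ω (j : Fin (l + 1)) => W (b + k + j) ω) μ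

/-- `p` is a (version of the) probability density of the random vector `V` with respect to
Lebesgue measure. -/
def IsDensity {Ω : Type*} [MeasurableSpace Ω] {d : ℕ} (μ : Measure Ω) (V : Ω → Rd d)
    (p : Rd d → ℝ) : Prop :=
  Measurable p ∧ (∀ x, 0 ≤ p x) ∧
    μ.map V = (volume : Measure (Rd d)).withDensity (fun x => ENNReal.ofReal (p x))

/-- The class `H₂^(α)(K)` of functions in `L₂(R^d)` that are `α`-Hölder in `L₂`-norm with
constant `K`, for shifts in the closed unit ball. -/
def MemH2 {d : ℕ} (α K : ℝ) (p : Rd d → ℝ) : Prop :=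
  MemLp p 2 volume ∧
    ∀ h : Rd d, ‖h‖ ≤ 1 → Real.sqrt (∫ x, (p (x - h) - p x) ^ 2) ≤ K * ‖h‖ ^ α

/-- The functional `q_{k,l} = ∫ p_X^k p_Y^l`. -/
def q {d : ℕ} (k l : ℕ) (pX pY : Rd d → ℝ) : ℝ :=
  ∫ x, pX x ^ k * pY x ^ l

/-- The volume `b_ε(d)` of a Euclidean ball of radius `ε` in `R^d`. -/
def ballVol (d : ℕ) (ε : ℝ) : ℝ :=
  (volume (Metric.closedBall (0 : Rd d) ε)).toReal

/-- The indicator of the event that the points `x` and `y` are `ε`-close. -/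
def close {d : ℕ} (ε : ℝ) (x y : Rd d) : ℝ :=
  if dist x y ≤ ε then 1 else 0

/-- Proportion of `ε`-close pairs `i < j` among the first `n` terms of one sequence. -/
def Qone {Ω : Type*} {d : ℕ} (X : ℕ → Ω → Rd d) (n : ℕ) (ε : ℝ) (ω : Ω) : ℝ :=
  (1 / (n.choose 2 : ℝ)) *
    ∑ j ∈ Finset.range n, ∑ i ∈ Finset.range j, close ε (X i ω) (X j ω)

/-- Proportion of `ε`-close pairs `(i, j)` between the first `n` terms of two sequences. -/
def Qtwo {Ω : Type*} {d : ℕ} (X Y : ℕ → Ω → Rd d) (n : ℕ) (ε : ℝ) (ω : Ω) : ℝ :=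
  (1 / (n : ℝ) ^ 2) *
    ∑ i ∈ Finset.range n, ∑ j ∈ Finset.range n, close ε (X i ω) (Y j ω)

/-- The `U`-statistic `Q_{k,l,n}`, for `(k,l) = (2,0), (1,1), (0,2)`. -/
def Q {Ω : Type*} {d : ℕ} (k l : ℕ) (X Y : ℕ → Ω → Rd d) (n : ℕ) (ε : ℝ) (ω : Ω) : ℝ :=
  match k, l with
  | 2, 0 => Qone X n ε ω
  | 1, 1 => Qtwo X Y n ε ω
  | 0, 2 => Qone Y n ε ω
  | _, _ => 0

/-- The estimator `Q̃_{k,l,n} = Q_{k,l,n} / b_ε(d)`. -/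
def Qtilde {Ω : Type*} {d : ℕ} (k l : ℕ) (X Y : ℕ → Ω → Rd d) (n : ℕ) (ε : ℝ) (ω : Ω) : ℝ :=
  Q k l X Y n ε ω / ballVol d ε

/-- The mean square error `E (Q̃_{k,l,n} - q_{k,l})²`. -/
def mse {Ω : Type*} [MeasurableSpace Ω] {d : ℕ} (μ : Measure Ω) (k l : ℕ)
    (X Y : ℕ → Ω → Rd d) (pX pY : Rd d → ℝ) (n : ℕ) (ε : ℝ) : ℝ :=
  ∫ ω, (Qtilde k l X Y n ε ω - q k l pX pY) ^ 2 ∂μ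

/-- `Var(ξ_1) + 2 ∑_{h=1}^m Cov(ξ_1, ξ_{1+h})` for a sequence `ξ` of random variables. -/
def longRunVar {Ω : Type*} [MeasurableSpace Ω] (μ : Measure Ω) (m : ℕ) (ξ : ℕ → Ω → ℝ) : ℝ :=
  variance (ξ 0) μ + 2 * ∑ h ∈ Finset.Icc 1 m, covariance (ξ 0) (ξ h) μ

/-- The variance characteristic `σ²_{k,l}`, for `(k,l) = (2,0), (1,1), (0,2)`. -/
def sigmaSq {Ω : Type*} [MeasurableSpace Ω] {d : ℕ} (μ : Measure Ω) (m k l : ℕ)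
    (X Y : ℕ → Ω → Rd d) (pX pY : Rd d → ℝ) : ℝ :=
  match k, l with
  | 2, 0 => longRunVar μ m (fun i ω => pX (X i ω))
  | 1, 1 => longRunVar μ m (fun i ω => (1 / 2 : ℝ) * (pY (X i ω) + pX (Y i ω)))
  | 0, 2 => longRunVar μ m (fun i ω => pY (Y i ω))
  | _, _ => 0

/-- Slowly varying functions (at infinity), in the sense of Karamata. -/
def SlowlyVarying (L : ℝ → ℝ) : Prop :=
  Measurable L ∧ (∀ᶠ x in atTop, 0 < L x) ∧
    ∀ t : ℝ, 0 < t → Tendsto (fun x => L (t * x) / L x) atTop (𝓝 1)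

end QuadDensity

end

namespace QuadDensity

/-! The proof is a Hoeffding decomposition relative to the product of the marginal laws. Write `b`
for the ball volume and `q` for `∫ pX * pY`. The kernel `close ε x y / b` has one-variable
projections `smooth ε pY x` and `smooth ε pX y`; subtracting them leaves the completely degenerate
`degKernel`. Hence the two-sample statistic minus `q` equals `linPart + D + T + bias`: an average
over `i` of `pY (X i) + pX (Y i) - 2 * q`, an average of `degKernel` over all pairs, a centred
average of smoothing errors, and a deterministic smoothing bias.

Each term has its own size in mean square. For `linPart`, stationarity and `m`-dependence give `n *
E linPart ^ 2 → 4 * σ²` by a Cesàro limit. In `E D ^ 2` a product over four indices vanishes as soon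
as one index is more than `m` from the other three; the `O(n ^ 2)` other quadruples are bounded
crudely by `(2 / b) ^ 2`, so no joint densities are needed and `E D ^ 2 = O((n * b) ^ (-2))`. `T` is
`o(1 / n)`, since smoothing converges in `L²` of the laws: Hölder's inequality and continuity of
translations in `L³`. The bias tends to zero, and under `MemH2` it is at most `(K * ε ^ α) ^ 2`:
because the ball is symmetric, only second differences of the correlation `u ↦ ∫ p x * p' (x + u)`
enter, and these are integrals of products of two first differences.

The one-sample statistics are the case `Y = X`, up to removal of the diagonal. With these bounds
packaged in `HasExpansion`, each of the three claims becomes a comparison of `(n * b) ^ (-2)`, `1 /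
n` and `ε ^ (4 * α)`. In the last claim the factor `L ^ (4 * α)` is absorbed by the fact that a
slowly varying function grows slower than every power. -/

/-! ### Slowly varying functions grow slower than any power -/

theorem eventually_three_halves_lt_volume (g : ℕ → ℝ → ℝ) (h0 : ∀ v, Tendsto (fun k => g k v) atTop (𝓝 0)) {η : ℝ} (hη : 0 < η) :
    ∀ᶠ N : ℕ in atTop,
      ENNReal.ofReal (3 / 2) < volume {v : ℝ | v ∈ Set.Icc (0 : ℝ) 2 ∧ ∀ k ≥ N, |g k v| < η} := by
  set V : ℕ → Set ℝ := fun N => {v : ℝ | v ∈ Set.Icc (0 : ℝ) 2 ∧ ∀ k ≥ N, |g k v| < η}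
  have hmono : Monotone V := fun N M hNM v hv => ⟨hv.1, fun k hk => hv.2 k (hNM.trans hk)⟩
  have hU : ⋃ N, V N = Set.Icc (0 : ℝ) 2 := by
    ext v
    simp only [Set.mem_iUnion]
    constructor
    · rintro ⟨N, hN⟩; exact hN.1
    · intro hv
      have := (h0 v).abs
      rw [abs_zero] at this
      obtain ⟨N, hN⟩ := eventually_atTop.1 (this.eventually_lt_const hη)
      exact ⟨N, hv, hN⟩
  have ht := tendsto_measure_iUnion_atTop (μ := (volume : Measure ℝ)) hmono
  rw [hU, Real.volume_Icc] at ht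
  refine ht.eventually_const_lt ?_
  rw [ENNReal.ofReal_lt_ofReal_iff] <;> norm_num

/-- The uniform convergence theorem for slowly varying functions, in additive form. -/
theorem exists_forall_abs_sub_le_of_tendsto (f : ℝ → ℝ) (hf : Measurable f)
    (h : ∀ u : ℝ, Tendsto (fun x => f (x + u) - f x) atTop (𝓝 0)) {δ : ℝ} (hδ : 0 < δ) :
    ∃ x₀ : ℝ, ∀ x ≥ x₀, ∀ u ∈ Set.Icc (0 : ℝ) 1, |f (x + u) - f x| ≤ δ := by
  by_contra! hcon
  choose x hx u hu hxu using fun n : ℕ => hcon n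
  have hxt : Tendsto x atTop atTop := tendsto_atTop_mono hx tendsto_natCast_atTop_atTop
  have hxut : Tendsto (fun k => x k + u k) atTop atTop :=
    tendsto_atTop_mono (fun k => by linarith [(hu k).1]) hxt
  have e1 := eventually_three_halves_lt_volume (fun k v => f (x k + v) - f (x k))
    (fun v => (h v).comp hxt) (half_pos hδ)
  have e2 := eventually_three_halves_lt_volume (fun k v => f (x k + u k + v) - f (x k + u k))
    (fun v => (h v).comp hxut) (half_pos hδ)
  -- Two sets of measure above `3 / 2` will be placed disjointly in an interval of length `3`, which
  -- is impossible.
  obtain ⟨N, hV, hW⟩ := (e1.and e2).exists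
  set V := {v : ℝ | v ∈ Set.Icc (0 : ℝ) 2 ∧ ∀ k ≥ N, |f (x k + v) - f (x k)| < δ / 2}
  set W := {v : ℝ | v ∈ Set.Icc (0 : ℝ) 2 ∧
    ∀ k ≥ N, |f (x k + u k + v) - f (x k + u k)| < δ / 2} with hWdef
  -- The translate `W + u N`. A common point `v` of `V` and `W'` would make `f (x N + v)` lie within
  -- `δ / 2` of both `f (x N)` and `f (x N + u N)`, against the choice of `u N`.
  set W' := (fun v => v + (- u N)) ⁻¹' W
  have hVm : MeasurableSet V := by
    have : V = Set.Icc 0 2 ∩ ⋂ k, ⋂ _ : k ≥ N, {v : ℝ | |f (x k + v) - f (x k)| < δ / 2} := by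
      ext v; simp [V]
    rw [this]
    exact measurableSet_Icc.inter <| MeasurableSet.iInter fun k => MeasurableSet.iInter fun _ =>
      measurableSet_lt (by fun_prop) measurable_const
  have hW' : volume W' = volume W := measure_preimage_add_right volume _ _
  have hdisj : Disjoint V W' := by
    rw [Set.disjoint_left]
    intro v hv hw
    have h1 := hv.2 N le_rfl
    have h2 := hw.2 N le_rfl
    have h3 := hxu N
    rw [show x N + u N + (v + -u N) = x N + v by ring] at h2
    rw [abs_lt] at h1 h2
    rcases lt_abs.1 h3 with h3 | h3 <;> linarith
  have hsub : V ∪ W' ⊆ Set.Icc (0 : ℝ) 3 := by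
    rintro v (hv | hv)
    · exact ⟨hv.1.1, by linarith [hv.1.2]⟩
    · have h1 := hv.1.1
      have h2 := hv.1.2
      have h3 := (hu N).1
      have h4 := (hu N).2
      exact ⟨by linarith, by linarith⟩
  have hle := measure_mono (μ := (volume : Measure ℝ)) hsub
  rw [measure_union' hdisj hVm, hW', Real.volume_Icc] at hle
  have := (ENNReal.add_lt_add hV hW).trans_le hle
  rw [← ENNReal.ofReal_add (by norm_num) (by norm_num)] at this
  norm_num at this

/-- By uniform convergence `f` rises by at most `δ` over any step of length at most one; unit steps
are chained from `x₀`, with one fractional step at the end. -/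
theorem exists_le_add_mul_of_tendsto (f : ℝ → ℝ) (hf : Measurable f)
    (h : ∀ u : ℝ, Tendsto (fun x => f (x + u) - f x) atTop (𝓝 0)) {δ : ℝ} (hδ : 0 < δ) :
    ∃ x₀ C : ℝ, ∀ x ≥ x₀, f x ≤ C + δ * x := by
  obtain ⟨x₀, hx₀⟩ := exists_forall_abs_sub_le_of_tendsto f hf h hδ
  have key : ∀ (n : ℕ), f (x₀ + n) ≤ f x₀ + δ * n := by
    intro n
    induction n with
    | zero => simp
    | succ n ih =>
      have := (abs_le.1 (hx₀ (x₀ + n) (by simp) 1 (by simp))).2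
      push_cast
      rw [← add_assoc]
      linarith
  refine ⟨x₀, f x₀ + δ - δ * x₀, fun x hx => ?_⟩
  have hfl := Nat.floor_le (sub_nonneg.2 hx)
  have hlt := Nat.lt_floor_add_one (x - x₀)
  have h1 := (abs_le.1 (hx₀ (x₀ + ⌊x - x₀⌋₊) (by simp) (x - x₀ - ⌊x - x₀⌋₊)
    ⟨by linarith, by linarith⟩)).2
  rw [show x₀ + (⌊x - x₀⌋₊ : ℝ) + (x - x₀ - ⌊x - x₀⌋₊) = x by ring] at h1
  have h2 := key ⌊x - x₀⌋₊
  nlinarith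

/-- In logarithmic coordinates, `x ↦ log (L (exp x))` has vanishing increments, so it lies below a
line of slope `δ`. -/
theorem SlowlyVarying.eventually_le_rpow {L : ℝ → ℝ} (hL : SlowlyVarying L) {δ : ℝ}
    (hδ : 0 < δ) : ∃ C : ℝ, 0 < C ∧ ∀ᶠ x in atTop, L x ≤ C * x ^ δ := by
  obtain ⟨hm, hpos, hlim⟩ := hL
  have ht : ∀ u : ℝ, Tendsto (fun x => Real.log (L (Real.exp (x + u))) -
      Real.log (L (Real.exp x))) atTop (𝓝 0) := by
    intro u
    have h1 := ((hlim (Real.exp u) (Real.exp_pos u)).comp Real.tendsto_exp_atTop).log one_ne_zero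
    rw [Real.log_one] at h1
    refine h1.congr' ?_
    have hp1 := Real.tendsto_exp_atTop.eventually hpos
    have hp2 := (Real.tendsto_exp_atTop.comp (tendsto_atTop_add_const_right atTop u
      tendsto_id)).eventually hpos
    filter_upwards [hp1, hp2] with x hx1 hx2
    simp only [Function.comp, id] at hx1 hx2 ⊢
    rw [← Real.exp_add, add_comm u x, Real.log_div hx2.ne' hx1.ne']
  obtain ⟨x₀, C, hC⟩ := exists_le_add_mul_of_tendsto (fun x => Real.log (L (Real.exp x)))
    (Real.measurable_log.comp (hm.comp Real.measurable_exp)) ht hδ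
  refine ⟨Real.exp C, Real.exp_pos C, ?_⟩
  filter_upwards [hpos, eventually_ge_atTop (Real.exp x₀), eventually_gt_atTop 0] with x hx hx0 hx1
  have := hC (Real.log x) ((Real.le_log_iff_exp_le hx1).2 hx0)
  rw [Real.exp_log hx1, Real.log_le_iff_le_exp hx, Real.exp_add] at this
  rwa [Real.rpow_def_of_pos hx1, mul_comm (Real.log x)]

/-! ### Independence in stationary `m`-dependent sequences -/

section Independence

variable {Ω S : Type*} [MeasurableSpace Ω] [MeasurableSpace S] {μ : Measure Ω}
  {m : ℕ} {W : ℕ → Ω → S}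

theorem MDependent.indepFun (hdep : MDependent μ m W) {i j : ℕ} (hij : i + m < j) :
    IndepFun (W i) (W j) μ := by
  have h := hdep i (j - i) 0 (by omega)
  have h2 : IndepFun (W i) (fun ω => W (i + (j - i) + 0) ω) μ :=
    h.comp (φ := fun v : Fin (i + 1) → S => v (Fin.last i))
    (ψ := fun v : Fin 1 → S => v 0)
    (by fun_prop) (by fun_prop)
  have e : i + (j - i) = j := by omega
  simpa [e] using h2

theorem StrictlyStationary.identDistrib_pair (hstat : StrictlyStationary μ W) (i j h : ℕ) :
    IdentDistrib (fun ω => (W i ω, W j ω)) (fun ω => (W (i + h) ω, W (j + h) ω)) μ μ :=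
  (hstat (max i j + 1) h).comp (u := fun v => (v ⟨i, by omega⟩, v ⟨j, by omega⟩))
    ((measurable_pi_apply _).prodMk (measurable_pi_apply _))

theorem StrictlyStationary.identDistrib (hstat : StrictlyStationary μ W) (i : ℕ) :
    IdentDistrib (W 0) (W i) μ μ := by
  simpa [Function.comp_def] using (hstat.identDistrib_pair 0 0 i).comp measurable_fst

/-- The two hypotheses make the joint law of `(P, A, F)` a triple product, whose factors may be
permuted. It is applied with `P` the past, `A` the present and `F` the future. -/
theorem indepFun_prodMk_of_indepFun {α β γ : Type*} [MeasurableSpace α] [MeasurableSpace β]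
    [MeasurableSpace γ] [IsProbabilityMeasure μ] {A : Ω → α} {P : Ω → β} {F : Ω → γ}
    (hA : Measurable A) (hP : Measurable P) (hF : Measurable F)
    (h1 : IndepFun P (fun ω => (A ω, F ω)) μ) (h2 : IndepFun A F μ) :
    IndepFun A (fun ω => (P ω, F ω)) μ := by
  have : IsProbabilityMeasure (μ.map A) := Measure.isProbabilityMeasure_map hA.aemeasurable
  have : IsProbabilityMeasure (μ.map P) := Measure.isProbabilityMeasure_map hP.aemeasurable
  have : IsProbabilityMeasure (μ.map F) := Measure.isProbabilityMeasure_map hF.aemeasurable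
  have h3 : IndepFun P F μ := h1.comp measurable_id measurable_snd
  rw [indepFun_iff_map_prod_eq_prod_map_map (by fun_prop) (by fun_prop)] at h1 h2 h3 ⊢
  rw [h3]
  rw [h2] at h1
  have hg : Measurable (fun z : β × α × γ => (z.2.1, (z.1, z.2.2))) := by fun_prop
  have e : μ.map (fun ω => (A ω, (P ω, F ω))) =
      (μ.map (fun ω => (P ω, (A ω, F ω)))).map (fun z => (z.2.1, (z.1, z.2.2))) := by
    rw [Measure.map_map hg (by fun_prop)]; rfl
  rw [e, h1]
  have e2 : (fun z : β × α × γ => (z.2.1, (z.1, z.2.2))) =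
      MeasurableEquiv.prodAssoc ∘ Prod.map Prod.swap id ∘ MeasurableEquiv.prodAssoc.symm := rfl
  rw [e2, ← Measure.map_map (by fun_prop) (by fun_prop),
    ← Measure.map_map (by fun_prop) (by fun_prop),
    ← Measure.prodAssoc_prod, MeasurableEquiv.map_symm_map, ← Measure.map_prod_map _ _ measurable_swap measurable_id, Measure.prod_swap,
    Measure.map_id, Measure.prodAssoc_prod]

/-- In an `m`-dependent sequence, a term is jointly independent of any three terms
at distance more than `m` from it. -/
theorem MDependent.indepFun_triple [IsProbabilityMeasure μ] (hW : ∀ i, Measurable (W i))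
    (hdep : MDependent μ m W) {i j k l : ℕ} (hj : j + m < i ∨ i + m < j)
    (hk : k + m < i ∨ i + m < k) (hl : l + m < i ∨ i + m < l) :
    IndepFun (W i) (fun ω => (W j ω, W k ω, W l ω)) μ := by
  set N := j + k + l
  have hAF : IndepFun (W i) (fun ω (t : Fin (N + 1)) => W (i + (m + 1) + t) ω) μ :=
    (hdep i (m + 1) N (by omega)).comp (φ := fun v : Fin (i + 1) → S => v (Fin.last i)) (ψ := id)
      (by fun_prop) measurable_id
  -- For `m < i` the past block `0, …, i - m - 1` is nonempty and is joined to the future block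
  -- starting at `i + m + 1`. For `i ≤ m` no index is more than `m` below `i`, so the future block
  -- contains all three.
  by_cases him : m < i
  · have hPAF : IndepFun (fun ω (t : Fin (i - m - 1 + 1)) => W t ω)
        (fun ω => (W i ω, fun t : Fin (N + 1) => W (i + (m + 1) + t) ω)) μ := by
      have h := hdep (i - m - 1) (m + 1) (m + 1 + N) (by omega)
      have h2 := h.comp (φ := id) (ψ := fun v : Fin (m + 1 + N + 1) → S => (v 0, fun t : Fin (N + 1) =>
        v ⟨m + 1 + t, by omega⟩)) measurable_id (by fun_prop)
      have e : i - m - 1 + (m + 1) = i := by omega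
      simpa [Function.comp_def, e, ← add_assoc] using h2
    have hind := indepFun_prodMk_of_indepFun (hW i) (by fun_prop) (by fun_prop) hPAF hAF
    have hcoord : ∀ j, j ≤ N → (j + m < i ∨ i + m < j) →
        ∃ ψ : (Fin (i - m - 1 + 1) → S) × (Fin (N + 1) → S) → S, Measurable ψ ∧
          ∀ ω, ψ (fun t => W t ω, fun t => W (i + (m + 1) + t) ω) = W j ω := by
      rintro j hjN (hj | hj)
      · exact ⟨fun z => z.1 ⟨j, by omega⟩, by fun_prop, fun ω => rfl⟩
      · refine ⟨fun z => z.2 ⟨j - (i + (m + 1)), by omega⟩, by fun_prop, fun ω => ?_⟩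
        simp only
        congr 1
        omega
    obtain ⟨ψ₁, hψ₁, e₁⟩ := hcoord j (by omega) hj
    obtain ⟨ψ₂, hψ₂, e₂⟩ := hcoord k (by omega) hk
    obtain ⟨ψ₃, hψ₃, e₃⟩ := hcoord l (by omega) hl
    have h2 := hind.comp (φ := id) measurable_id (hψ₁.prodMk (hψ₂.prodMk hψ₃))
    simpa [Function.comp_def, e₁, e₂, e₃] using h2
  · have h2 := hAF.comp (φ := id) (ψ := fun v : Fin (N + 1) → S => (v ⟨j - (i + (m + 1)), by omega⟩,
      v ⟨k - (i + (m + 1)), by omega⟩, v ⟨l - (i + (m + 1)), by omega⟩)) measurable_id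
      (by fun_prop)
    have e1 : i + (m + 1) + (j - (i + (m + 1))) = j := by omega
    have e2 : i + (m + 1) + (k - (i + (m + 1))) = k := by omega
    have e3 : i + (m + 1) + (l - (i + (m + 1))) = l := by omega
    simpa [Function.comp_def, e1, e2, e3] using h2

theorem integral_eq_zero_of_indepFun {α β : Type*} [MeasurableSpace α] [MeasurableSpace β]
    [IsProbabilityMeasure μ] {A : Ω → α} {V : Ω → β} (hA : Measurable A) (hV : Measurable V)
    (h : IndepFun A V μ) {φ : α × β → ℝ} (hφ : Measurable φ) {C : ℝ} (hC : ∀ z, |φ z| ≤ C)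
    (h0 : ∀ v, ∫ a, φ (a, v) ∂(μ.map A) = 0) : ∫ ω, φ (A ω, V ω) ∂μ = 0 := by
  have : IsProbabilityMeasure (μ.map A) := Measure.isProbabilityMeasure_map hA.aemeasurable
  have : IsProbabilityMeasure (μ.map V) := Measure.isProbabilityMeasure_map hV.aemeasurable
  rw [indepFun_iff_map_prod_eq_prod_map_map (by fun_prop) (by fun_prop)] at h
  have e : ∫ ω, φ (A ω, V ω) ∂μ = ∫ z, φ z ∂(μ.map fun ω => (A ω, V ω)) :=
    (integral_map (by fun_prop) hφ.aestronglyMeasurable).symm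
  have hint : Integrable φ ((μ.map A).prod (μ.map V)) :=
    Integrable.of_bound hφ.aestronglyMeasurable C (ae_of_all _ hC)
  rw [e, h, integral_prod_symm _ hint]
  simp [h0]

end Independence

/-! ### Counting index pairs close to the diagonal -/

section Band

/-- The indicator of `|i - j| ≤ M`. -/
noncomputable def band (M i j : ℕ) : ℝ := if i ≤ j + M ∧ j ≤ i + M then 1 else 0

theorem band_nonneg (M i j : ℕ) : 0 ≤ band M i j := by
  unfold band; split_ifs <;> norm_num

theorem sum_band_le (M n i : ℕ) : ∑ j ∈ Finset.range n, band M i j ≤ 2 * M + 1 := by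
  unfold band
  rw [Finset.sum_boole]
  have : ((Finset.range n).filter fun j => i ≤ j + M ∧ j ≤ i + M) ⊆
      Finset.Icc (i - M) (i + M) := by
    intro j; simp only [Finset.mem_filter, Finset.mem_Icc]; omega
  have h := Finset.card_le_card this
  rw [Nat.card_Icc] at h
  have h2 : ((Finset.range n).filter fun j => i ≤ j + M ∧ j ≤ i + M).card ≤ 2 * M + 1 := by omega
  exact_mod_cast h2

theorem sum_sum_band_le (M n : ℕ) :
    ∑ i ∈ Finset.range n, ∑ j ∈ Finset.range n, band M i j ≤ n * (2 * M + 1) := by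
  refine (Finset.sum_le_sum fun i _ => sum_band_le M n i).trans ?_
  simp [mul_add]

end Band

/-! ### Second moments of sums of `m`-dependent variables -/

section LinearPart

variable {Ω : Type*} [MeasurableSpace Ω] {μ : Measure Ω}

theorem integral_sum_sq {ξ : ℕ → Ω → ℝ} (hξ : ∀ i, MemLp (ξ i) 2 μ) (n : ℕ) :
    ∫ ω, (∑ i ∈ Finset.range n, ξ i ω) ^ 2 ∂μ =
      ∑ i ∈ Finset.range n, ∑ j ∈ Finset.range n, ∫ ω, ξ i ω * ξ j ω ∂μ := by
  have hint : ∀ i j, Integrable (fun ω => ξ i ω * ξ j ω) μ := fun i j =>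
    (hξ i).integrable_mul (hξ j)
  simp_rw [sq, Finset.sum_mul_sum]
  rw [integral_finsetSum _ fun i _ => integrable_finsetSum _ fun j _ => hint i j]
  exact Finset.sum_congr rfl fun i _ => integral_finsetSum _ fun j _ => hint i j

/-- Each index has at most `2 * m + 1` partners with nonzero product moment, and each such moment is
at most `v` by the inequality between arithmetic and geometric means. -/
theorem integral_sum_sq_le {η : ℕ → Ω → ℝ} (hη : ∀ i, MemLp (η i) 2 μ) {m : ℕ} {v : ℝ}
    (hv : ∀ i, ∫ ω, η i ω ^ 2 ∂μ ≤ v)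
    (h0 : ∀ i j, i + m < j → ∫ ω, η i ω * η j ω ∂μ = 0) (n : ℕ) :
    ∫ ω, (∑ i ∈ Finset.range n, η i ω) ^ 2 ∂μ ≤ n * (2 * m + 1) * v := by
  have hv0 : 0 ≤ v := (integral_nonneg fun ω => sq_nonneg _).trans (hv 0)
  rw [integral_sum_sq hη]
  have hij : ∀ i j, ∫ ω, η i ω * η j ω ∂μ ≤ band m i j * v := by
    intro i j
    unfold band
    split_ifs with hb
    · have h1 : ∫ ω, η i ω * η j ω ∂μ ≤ ∫ ω, (1 / 2 * η i ω ^ 2 + 1 / 2 * η j ω ^ 2) ∂μ := by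
        refine integral_mono ((hη i).integrable_mul (hη j))
          (((hη i).integrable_sq.const_mul _).add ((hη j).integrable_sq.const_mul _)) fun ω => ?_
        simp only
        nlinarith [sq_nonneg (η i ω - η j ω)]
      rw [integral_add ((hη i).integrable_sq.const_mul _) ((hη j).integrable_sq.const_mul _),
        integral_const_mul, integral_const_mul] at h1
      linarith [hv i, hv j]
    · rw [zero_mul]
      rcases lt_or_ge (j + m) i with h | h
      · simp_rw [mul_comm (η i _)]
        exact (h0 j i h).le
      · exact (h0 i j (by omega)).le
  calc _ ≤ ∑ i ∈ Finset.range n, ∑ j ∈ Finset.range n, band m i j * v :=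
        Finset.sum_le_sum fun i _ => Finset.sum_le_sum fun j _ => hij i j
    _ = (∑ i ∈ Finset.range n, ∑ j ∈ Finset.range n, band m i j) * v := by
        simp_rw [Finset.sum_mul]
    _ ≤ _ := mul_le_mul_of_nonneg_right (sum_sum_band_le m n) hv0

/-- With truncated subtraction `(i - j) + (j - i)` is `|i - j|`. The double sums have increments
that become constant, so their averages converge by Cesàro. -/
theorem tendsto_sum_sum_div (γ : ℕ → ℝ) (m : ℕ) (h0 : ∀ h, m < h → γ h = 0) :
    Tendsto (fun n : ℕ => (n : ℝ)⁻¹ *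
      ∑ i ∈ Finset.range n, ∑ j ∈ Finset.range n, γ ((i - j) + (j - i))) atTop
      (𝓝 (γ 0 + 2 * ∑ h ∈ Finset.Icc 1 m, γ h)) := by
  -- `u n` is the gain when index `n` joins the square: the diagonal entry and two equal borders.
  set u : ℕ → ℝ := fun n => γ 0 + 2 * ∑ h ∈ Finset.Icc 1 n, γ h with hu
  have hT : ∀ n : ℕ, ∑ i ∈ Finset.range n, ∑ j ∈ Finset.range n, γ ((i - j) + (j - i)) =
      ∑ k ∈ Finset.range n, u k := by
    intro n
    induction n with
    | zero => simp
    | succ n ih =>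
      have hrefl : ∑ i ∈ Finset.range n, γ (n - i) = ∑ h ∈ Finset.Icc 1 n, γ h := by
        rw [← Finset.sum_range_reflect, ← Finset.Ico_add_one_right_eq_Icc,
          Finset.sum_Ico_eq_sum_range]
        refine Finset.sum_congr (by simp) fun i hi => ?_
        congr 1
        have := Finset.mem_range.1 hi
        omega
      rw [Finset.sum_range_succ _ n, Finset.sum_range_succ u n, ← ih]
      simp_rw [Finset.sum_range_succ _ n]
      rw [Finset.sum_add_distrib]
      have h1 : ∑ i ∈ Finset.range n, γ (i - n + (n - i)) = ∑ h ∈ Finset.Icc 1 n, γ h := by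
        rw [← hrefl]
        refine Finset.sum_congr rfl fun i hi => ?_
        congr 1
        have := Finset.mem_range.1 hi
        omega
      have h2 : ∑ i ∈ Finset.range n, γ (n - i + (i - n)) = ∑ h ∈ Finset.Icc 1 n, γ h := by
        rw [← h1]
        exact Finset.sum_congr rfl fun i _ => by rw [add_comm]
      rw [h1, h2]
      simp [hu]
      ring
  have hlim : Tendsto u atTop (𝓝 (u m)) := by
    refine tendsto_const_nhds.congr' ?_
    filter_upwards [eventually_ge_atTop m] with n hn
    simp only [hu]
    congr 2
    refine Finset.sum_subset (Finset.Icc_subset_Icc_right hn) fun h _ hh => h0 h ?_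
    simp only [Finset.mem_Icc, not_and, not_le] at *
    exact hh (by omega)
  simp_rw [hT]
  exact hlim.cesaro

end LinearPart

/-! ### Double sums of a bounded completely degenerate kernel -/

section Degenerate

variable {Ω E : Type*} [MeasurableSpace Ω] [MeasurableSpace E] {μ : Measure Ω}
  [IsProbabilityMeasure μ] {m : ℕ} {X Y : ℕ → Ω → E}

/-- If no pairing of the indices `i, j, k, l` consists of pairs at distance at most `2 * m`, then
one of the indices is at distance more than `m` from the others. -/
theorem band_pairing_or_isolated (m i j k l : ℕ) :
    (1 ≤ band (2 * m) i j * band (2 * m) k l + band (2 * m) i k * band (2 * m) j l +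
      band (2 * m) i l * band (2 * m) j k) ∨
    ((j + m < i ∨ i + m < j) ∧ (k + m < i ∨ i + m < k) ∧ (l + m < i ∨ i + m < l)) ∨
    ((i + m < j ∨ j + m < i) ∧ (k + m < j ∨ j + m < k) ∧ (l + m < j ∨ j + m < l)) ∨
    ((l + m < k ∨ k + m < l) ∧ (i + m < k ∨ k + m < i) ∧ (j + m < k ∨ k + m < j)) ∨
    ((k + m < l ∨ l + m < k) ∧ (i + m < l ∨ l + m < i) ∧ (j + m < l ∨ l + m < j)) := by
  have hb := band_nonneg (2 * m)
  have hone : ∀ a b, (a ≤ b + 2 * m ∧ b ≤ a + 2 * m) → band (2 * m) a b = 1 := fun a b h => by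
    simp [band, h]
  have h1 := mul_nonneg (hb i j) (hb k l)
  have h2 := mul_nonneg (hb i k) (hb j l)
  have h3 := mul_nonneg (hb i l) (hb j k)
  by_cases c1 : (i ≤ j + 2 * m ∧ j ≤ i + 2 * m) ∧ (k ≤ l + 2 * m ∧ l ≤ k + 2 * m)
  · left; rw [hone i j c1.1, hone k l c1.2] at *; linarith
  by_cases c2 : (i ≤ k + 2 * m ∧ k ≤ i + 2 * m) ∧ (j ≤ l + 2 * m ∧ l ≤ j + 2 * m)
  · left; rw [hone i k c2.1, hone j l c2.2] at *; linarith
  by_cases c3 : (i ≤ l + 2 * m ∧ l ≤ i + 2 * m) ∧ (j ≤ k + 2 * m ∧ k ≤ j + 2 * m)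
  · left; rw [hone i l c3.1, hone j k c3.2] at *; linarith
  -- Join indices at distance at most `m`. A graph on four vertices without isolated vertex contains
  -- a perfect matching or is a star, and the leaves of a star are within `2 * m` of each other;
  -- this is why the pairings use `2 * m`.
  right
  omega

/-- The isolated `X i` is independent of the other three variables, so it can be integrated out
first, and degeneracy in the first argument gives zero. -/
theorem integral_mul_eq_zero_of_isolated_left (hX : ∀ i, Measurable (X i))
    (hY : ∀ i, Measurable (Y i)) (hdep : MDependent μ m (fun i ω => (X i ω, Y i ω)))
    {r : E × E → ℝ} (hr : Measurable r) {C : ℝ} (hC : ∀ z, |r z| ≤ C) {i j k l : ℕ}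
    (h0 : ∀ y, ∫ x, r (x, y) ∂(μ.map (X i)) = 0) (hj : j + m < i ∨ i + m < j)
    (hk : k + m < i ∨ i + m < k) (hl : l + m < i ∨ i + m < l) :
    ∫ ω, r (X i ω, Y j ω) * r (X k ω, Y l ω) ∂μ = 0 := by
  have hind := (hdep.indepFun_triple (fun i => (hX i).prodMk (hY i)) hj hk hl).comp
    (φ := Prod.fst) (ψ := fun z : (E × E) × (E × E) × (E × E) => (z.1.2, z.2.1.1, z.2.2.2))
    measurable_fst (by fun_prop)
  refine integral_eq_zero_of_indepFun (hX i) (V := fun ω => (Y j ω, X k ω, Y l ω)) (by fun_prop)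
    hind (φ := fun z => r (z.1, z.2.1) * r z.2.2) (by fun_prop) (C := C * C) (fun z => ?_)
    (fun v => ?_)
  · rw [abs_mul]
    exact mul_le_mul (hC _) (hC _) (abs_nonneg _) ((abs_nonneg _).trans (hC z.2.2))
  · dsimp only
    rw [integral_mul_const, h0, zero_mul]

theorem integral_mul_eq_zero_of_isolated_right (hX : ∀ i, Measurable (X i))
    (hY : ∀ i, Measurable (Y i)) (hdep : MDependent μ m (fun i ω => (X i ω, Y i ω)))
    {r : E × E → ℝ} (hr : Measurable r) {C : ℝ} (hC : ∀ z, |r z| ≤ C) {i j k l : ℕ}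
    (h0 : ∀ x, ∫ y, r (x, y) ∂(μ.map (Y j)) = 0) (hi : i + m < j ∨ j + m < i)
    (hk : k + m < j ∨ j + m < k) (hl : l + m < j ∨ j + m < l) :
    ∫ ω, r (X i ω, Y j ω) * r (X k ω, Y l ω) ∂μ = 0 := by
  have hind := (hdep.indepFun_triple (fun i => (hX i).prodMk (hY i)) hi hk hl).comp
    (φ := Prod.snd) (ψ := fun z : (E × E) × (E × E) × (E × E) => (z.1.1, z.2.1.1, z.2.2.2))
    measurable_snd (by fun_prop)
  refine integral_eq_zero_of_indepFun (hY j) (V := fun ω => (X i ω, X k ω, Y l ω)) (by fun_prop)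
    hind (φ := fun z => r (z.2.1, z.1) * r z.2.2) (by fun_prop) (C := C * C) (fun z => ?_)
    (fun v => ?_)
  · rw [abs_mul]
    exact mul_le_mul (hC _) (hC _) (abs_nonneg _) ((abs_nonneg _).trans (hC z.2.2))
  · dsimp only
    rw [integral_mul_const, h0, zero_mul]

/-- Either an index is isolated and the moment vanishes, or some pairing term equals one and the
trivial bound `C ^ 2` suffices. Nothing is assumed about the dependence of nearby terms. -/
theorem integral_mul_le_of_degenerate (hX : ∀ i, Measurable (X i))
    (hY : ∀ i, Measurable (Y i)) (hdep : MDependent μ m (fun i ω => (X i ω, Y i ω)))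
    {r : E × E → ℝ} (hr : Measurable r) {C : ℝ} (hC : ∀ z, |r z| ≤ C)
    (h1 : ∀ i y, ∫ x, r (x, y) ∂(μ.map (X i)) = 0)
    (h2 : ∀ j x, ∫ y, r (x, y) ∂(μ.map (Y j)) = 0) (i j k l : ℕ) :
    ∫ ω, r (X i ω, Y j ω) * r (X k ω, Y l ω) ∂μ ≤
      C ^ 2 * (band (2 * m) i j * band (2 * m) k l + band (2 * m) i k * band (2 * m) j l +
        band (2 * m) i l * band (2 * m) j k) := by
  have hb := band_nonneg (2 * m)
  have hnn : 0 ≤ C ^ 2 * (band (2 * m) i j * band (2 * m) k l +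
      band (2 * m) i k * band (2 * m) j l + band (2 * m) i l * band (2 * m) j k) := by
    have := mul_nonneg (hb i j) (hb k l)
    have := mul_nonneg (hb i k) (hb j l)
    have := mul_nonneg (hb i l) (hb j k)
    positivity
  rcases band_pairing_or_isolated m i j k l with h | ⟨a, b, c⟩ | ⟨a, b, c⟩ | ⟨a, b, c⟩ | ⟨a, b, c⟩
  · have hle : ∀ ω, ‖r (X i ω, Y j ω) * r (X k ω, Y l ω)‖ ≤ C ^ 2 := fun ω => by
      rw [Real.norm_eq_abs, abs_mul, sq]
      exact mul_le_mul (hC _) (hC _) (abs_nonneg _) ((abs_nonneg _).trans (hC (X k ω, Y l ω)))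
    have := norm_integral_le_of_norm_le_const (μ := μ) (ae_of_all _ hle)
    rw [probReal_univ, mul_one] at this
    exact ((le_abs_self _).trans this).trans (le_mul_of_one_le_right (sq_nonneg C) h)
  · rw [integral_mul_eq_zero_of_isolated_left hX hY hdep hr hC (h1 i) a b c]; exact hnn
  · rw [integral_mul_eq_zero_of_isolated_right hX hY hdep hr hC (h2 j) a b c]; exact hnn
  · simp_rw [mul_comm (r (X i _, _))]
    rw [integral_mul_eq_zero_of_isolated_left hX hY hdep hr hC (h1 k) a b c]; exact hnn
  · simp_rw [mul_comm (r (X i _, _))]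
    rw [integral_mul_eq_zero_of_isolated_right hX hY hdep hr hC (h2 l) a b c]; exact hnn

/-- Second moment bound for a double sum of a bounded completely degenerate kernel. -/
theorem integral_sum_degenerate_sq_le (hX : ∀ i, Measurable (X i))
    (hY : ∀ i, Measurable (Y i)) (hdep : MDependent μ m (fun i ω => (X i ω, Y i ω)))
    {r : E × E → ℝ} (hr : Measurable r) {C : ℝ} (hC : ∀ z, |r z| ≤ C)
    (h1 : ∀ i y, ∫ x, r (x, y) ∂(μ.map (X i)) = 0)
    (h2 : ∀ j x, ∫ y, r (x, y) ∂(μ.map (Y j)) = 0) (n : ℕ) :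
    ∫ ω, (∑ i ∈ Finset.range n, ∑ j ∈ Finset.range n, r (X i ω, Y j ω)) ^ 2 ∂μ ≤
      3 * C ^ 2 * (n * (4 * m + 1)) ^ 2 := by
  have hint : ∀ i j k l, Integrable (fun ω => r (X i ω, Y j ω) * r (X k ω, Y l ω)) μ := by
    intro i j k l
    refine Integrable.of_bound (by fun_prop) (C * C) (ae_of_all _ fun ω => ?_)
    rw [Real.norm_eq_abs, abs_mul]
    exact mul_le_mul (hC _) (hC _) (abs_nonneg _) ((abs_nonneg _).trans (hC (X k ω, Y l ω)))
  set R := Finset.range n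
  set β : ℕ → ℕ → ℝ := band (2 * m)
  have hexp : ∫ ω, (∑ i ∈ R, ∑ j ∈ R, r (X i ω, Y j ω)) ^ 2 ∂μ =
      ∑ i ∈ R, ∑ j ∈ R, ∑ k ∈ R, ∑ l ∈ R, ∫ ω, r (X i ω, Y j ω) * r (X k ω, Y l ω) ∂μ := by
    simp_rw [sq, Finset.sum_mul, Finset.mul_sum]
    rw [integral_finsetSum _ fun i _ => integrable_finsetSum _ fun j _ =>
      integrable_finsetSum _ fun k _ => integrable_finsetSum _ fun l _ => hint i j k l]
    refine Finset.sum_congr rfl fun i _ => ?_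
    rw [integral_finsetSum _ fun j _ =>
      integrable_finsetSum _ fun k _ => integrable_finsetSum _ fun l _ => hint i j k l]
    refine Finset.sum_congr rfl fun j _ => ?_
    rw [integral_finsetSum _ fun k _ => integrable_finsetSum _ fun l _ => hint i j k l]
    exact Finset.sum_congr rfl fun k _ => integral_finsetSum _ fun l _ => hint i j k l
  set s := ∑ i ∈ R, ∑ j ∈ R, β i j with hs
  -- Each of the three pairings sums to the square of the band count, hence the order `n ^ 2` rather
  -- than `n ^ 4`.
  have e1 : ∑ i ∈ R, ∑ j ∈ R, ∑ k ∈ R, ∑ l ∈ R, β i j * β k l = s * s := by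
    simp_rw [hs, Finset.sum_mul, Finset.mul_sum]
  have e2 : ∑ i ∈ R, ∑ j ∈ R, ∑ k ∈ R, ∑ l ∈ R, β i k * β j l = s * s := by
    rw [← e1]
    exact Finset.sum_congr rfl fun i _ => Finset.sum_comm
  have e3 : ∑ i ∈ R, ∑ j ∈ R, ∑ k ∈ R, ∑ l ∈ R, β i l * β j k = s * s := by
    rw [← e2]
    exact Finset.sum_congr rfl fun i _ => Finset.sum_congr rfl fun j _ => Finset.sum_comm
  have hs0 : 0 ≤ s := Finset.sum_nonneg fun i _ => Finset.sum_nonneg fun j _ => band_nonneg _ _ _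
  have hsle : s ≤ n * (4 * m + 1) := by
    refine (sum_sum_band_le (2 * m) n).trans (le_of_eq ?_)
    push_cast; ring
  rw [hexp]
  calc _ ≤ ∑ i ∈ R, ∑ j ∈ R, ∑ k ∈ R, ∑ l ∈ R,
          C ^ 2 * (β i j * β k l + β i k * β j l + β i l * β j k) :=
        Finset.sum_le_sum fun i _ => Finset.sum_le_sum fun j _ => Finset.sum_le_sum fun k _ =>
          Finset.sum_le_sum fun l _ => integral_mul_le_of_degenerate hX hY hdep hr hC h1 h2 i j k l
    _ = C ^ 2 * (s * s + s * s + s * s) := by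
        simp_rw [← Finset.mul_sum, Finset.sum_add_distrib, e1, e2, e3]
    _ = 3 * C ^ 2 * s ^ 2 := by ring
    _ ≤ _ := by gcongr

end Degenerate

open scoped ENNReal

/-! ### Averaging a density over small balls -/

section Smoothing

variable {d : ℕ}

theorem exists_ballVol_eq (d : ℕ) : ∃ v : ℝ, 0 < v ∧ ∀ ε, 0 ≤ ε → ballVol d ε = v * ε ^ d := by
  refine ⟨(volume (Metric.ball (0 : Rd d) 1)).toReal,
    ENNReal.toReal_pos (Metric.measure_ball_pos _ _ one_pos).ne' measure_ball_lt_top.ne,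
    fun ε hε => ?_⟩
  unfold ballVol
  rw [Measure.addHaar_closedBall _ _ hε, ENNReal.toReal_mul, ENNReal.toReal_ofReal (by positivity),
    mul_comm]
  simp

theorem ballVol_pos {ε : ℝ} (hε : 0 < ε) : 0 < ballVol d ε := by
  obtain ⟨v, hv, h⟩ := exists_ballVol_eq d
  rw [h ε hε.le]
  positivity

/-- The average of `p` over the balls of radius `ε`. -/
noncomputable def smooth (ε : ℝ) (p : Rd d → ℝ) (x : Rd d) : ℝ :=
  (ballVol d ε)⁻¹ * ∫ u in Metric.closedBall (0 : Rd d) ε, p (x + u)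

/-- The measure with density `p` with respect to Lebesgue measure. -/
noncomputable def law (p : Rd d → ℝ) : Measure (Rd d) :=
  (volume : Measure (Rd d)).withDensity (fun x => ENNReal.ofReal (p x))

theorem integral_law {p : Rd d → ℝ} (hp : Measurable p) (h0 : ∀ x, 0 ≤ p x) (f : Rd d → ℝ) :
    ∫ x, f x ∂law p = ∫ x, p x * f x := by
  unfold law
  rw [integral_withDensity_eq_integral_toReal_smul (by fun_prop) (by simp)]
  simp [ENNReal.toReal_ofReal (h0 _)]

theorem measurable_close (ε : ℝ) : Measurable fun z : Rd d × Rd d => close ε z.1 z.2 :=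
  Measurable.ite (measurableSet_le (by fun_prop) measurable_const) measurable_const
    measurable_const

theorem integral_close_law {p : Rd d → ℝ} (hp : Measurable p) (h0 : ∀ x, 0 ≤ p x) (ε : ℝ)
    (x : Rd d) : ∫ y, close ε x y / ballVol d ε ∂law p = smooth ε p x := by
  rw [integral_law hp h0, smooth, ← integral_add_left_eq_self _ x,
    ← integral_indicator Metric.isClosed_closedBall.measurableSet, ← integral_const_mul]
  refine integral_congr_ae (ae_of_all _ fun u => ?_)
  by_cases hu : u ∈ Metric.closedBall (0 : Rd d) ε
  · have : ‖u‖ ≤ ε := by simpa using hu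
    simp [close, this]
    ring
  · have : ¬ ‖u‖ ≤ ε := by simpa using hu
    simp [close, this]

theorem close_comm (ε : ℝ) (x y : Rd d) : close ε x y = close ε y x := by
  simp [close, dist_comm]

theorem smooth_sub {p : Rd d → ℝ} (hp : Integrable p) {ε : ℝ} (hε : 0 < ε) (x : Rd d) :
    smooth ε p x - p x =
      (ballVol d ε)⁻¹ * ∫ u in Metric.closedBall (0 : Rd d) ε, (p (x + u) - p x) := by
  have hfin : volume (Metric.closedBall (0 : Rd d) ε) ≠ ∞ := measure_closedBall_lt_top.ne
  rw [integral_sub (hp.comp_add_left x).integrableOn (integrableOn_const hfin),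
    mul_sub, smooth, setIntegral_const, smul_eq_mul]
  have : volume.real (Metric.closedBall (0 : Rd d) ε) = ballVol d ε := rfl
  rw [this, inv_mul_cancel_left₀ (ballVol_pos hε).ne']

/-- Continuity of translations in `L^r`, obtained from the continuity of composition with
measure-preserving maps. -/
theorem tendsto_eLpNorm_translate_sub {p : Rd d → ℝ} {r : ℝ≥0∞} (hr : 1 ≤ r) (hr' : r ≠ ∞)
    (hp : MemLp p r volume) :
    Tendsto (fun u => eLpNorm (fun x => p (x + u) - p x) r volume) (𝓝 0) (𝓝 0) := by
  have : Fact (1 ≤ r) := ⟨hr⟩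
  let G : C(Rd d, C(Rd d, Rd d)) :=
    ContinuousMap.curry ⟨fun z : Rd d × Rd d => z.2 + z.1, by fun_prop⟩
  have hG : ∀ u, MeasurePreserving (G u) (volume : Measure (Rd d)) volume := fun u =>
    measurePreserving_add_right volume u
  have ht := Filter.Tendsto.compMeasurePreservingLp (f := fun _ : Rd d => hp.toLp p)
    tendsto_const_nhds (G.continuous.tendsto 0) hG (hG 0) hr'
  rw [tendsto_iff_edist_tendsto_0] at ht
  refine ht.congr fun u => ?_
  rw [Lp.edist_def]
  refine eLpNorm_congr_ae ?_
  have h1 := Lp.coeFn_compMeasurePreserving (hp.toLp p) (hG u)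
  have h2 := Lp.coeFn_compMeasurePreserving (hp.toLp p) (hG 0)
  have h3 := (hG u).quasiMeasurePreserving.ae_eq_comp hp.coeFn_toLp
  have h4 := (hG 0).quasiMeasurePreserving.ae_eq_comp hp.coeFn_toLp
  filter_upwards [h1, h2, h3, h4] with x h1 h2 h3 h4
  simp only [Pi.sub_apply]
  rw [h1, h2, h3, h4]
  simp [G]

theorem enorm_integral_sq_le {α : Type*} [MeasurableSpace α] (ν : Measure α) {f : α → ℝ}
    (hf : AEMeasurable f ν) : ‖∫ x, f x ∂ν‖ₑ ^ 2 ≤ ν Set.univ * ∫⁻ x, ‖f x‖ₑ ^ 2 ∂ν := by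
  have h1 : ‖∫ x, f x ∂ν‖ₑ ≤ ∫⁻ x, ‖f x‖ₑ ∂ν := enorm_integral_le_lintegral_enorm _
  have h2 := ENNReal.lintegral_mul_le_Lp_mul_Lq ν Real.HolderConjugate.two_two
    (f := fun _ => 1) aemeasurable_const hf.enorm
  simp only [Pi.mul_apply, one_mul, ENNReal.one_rpow, lintegral_const] at h2
  calc ‖∫ x, f x ∂ν‖ₑ ^ 2 ≤ (ν Set.univ ^ (1 / 2 : ℝ) *
        (∫⁻ x, ‖f x‖ₑ ^ (2 : ℝ) ∂ν) ^ (1 / 2 : ℝ)) ^ 2 := by gcongr; exact h1.trans h2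
    _ = ν Set.univ * ∫⁻ x, ‖f x‖ₑ ^ (2 : ℝ) ∂ν := by
        rw [mul_pow, ← ENNReal.rpow_mul_natCast, ← ENNReal.rpow_mul_natCast]
        norm_num
    _ = _ := by simp

/-- Hölder with exponents `3 / 2` and `3`. This is how `L₃` densities control `L²` norms taken under
another density. -/
theorem lintegral_enorm_sq_mul_enorm_le {α : Type*} [MeasurableSpace α] (ν : Measure α)
    {f g : α → ℝ} (hf : AEMeasurable f ν) (hg : AEMeasurable g ν) :
    ∫⁻ x, ‖f x‖ₑ ^ 2 * ‖g x‖ₑ ∂ν ≤ eLpNorm f 3 ν ^ 2 * eLpNorm g 3 ν := by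
  have hpq : (3 / 2 : ℝ).HolderConjugate 3 := by
    rw [Real.holderConjugate_iff]; norm_num
  have h := ENNReal.lintegral_mul_le_Lp_mul_Lq ν hpq (hf.enorm.pow_const 2) hg.enorm
  refine h.trans (le_of_eq ?_)
  rw [eLpNorm_eq_lintegral_rpow_enorm_toReal (by norm_num) (by norm_num),
    eLpNorm_eq_lintegral_rpow_enorm_toReal (by norm_num) (by norm_num)]
  congr 1
  rw [← ENNReal.rpow_mul_natCast]
  congr 1
  · refine lintegral_congr fun x => ?_
    rw [← ENNReal.rpow_natCast_mul]
    norm_num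
  · norm_num

/-- By Cauchy–Schwarz the squared mean over the ball is at most the mean of squares; after
exchanging integrals, Hölder bounds the inner integral for each shift `u` separately. -/
theorem lintegral_enorm_smooth_sub_sq_le {p p' : Rd d → ℝ} (hp : Measurable p)
    (hpi : Integrable p) (hp' : Measurable p') {ε : ℝ} (hε : 0 < ε) {τ : ℝ≥0∞}
    (hτ : ∀ u : Rd d, ‖u‖ ≤ ε → eLpNorm (fun x => p (x + u) - p x) 3 volume ≤ τ) :
    ∫⁻ x, ‖smooth ε p x - p x‖ₑ ^ 2 * ‖p' x‖ₑ ≤ τ ^ 2 * eLpNorm p' 3 volume := by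
  set B := Metric.closedBall (0 : Rd d) ε
  have hBm : MeasurableSet B := Metric.isClosed_closedBall.measurableSet
  have hfin : volume B ≠ ∞ := measure_closedBall_lt_top.ne
  have hb : ‖(ballVol d ε)⁻¹‖ₑ = (volume B)⁻¹ := by
    rw [Real.enorm_eq_ofReal (inv_nonneg.2 (ballVol_pos hε).le),
      ENNReal.ofReal_inv_of_pos (ballVol_pos hε)]
    unfold ballVol
    rw [ENNReal.ofReal_toReal hfin]
  have hB0 : volume B ≠ 0 := (Metric.measure_closedBall_pos _ _ hε).ne'
  have hpt : ∀ x, ‖smooth ε p x - p x‖ₑ ^ 2 ≤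
      (volume B)⁻¹ * ∫⁻ u in B, ‖p (x + u) - p x‖ₑ ^ 2 := by
    intro x
    rw [smooth_sub hpi hε, enorm_mul, hb, mul_pow]
    have := enorm_integral_sq_le (volume.restrict B) (f := fun u => p (x + u) - p x)
      (by fun_prop)
    rw [Measure.restrict_apply_univ] at this
    calc _ ≤ (volume B)⁻¹ ^ 2 * (volume B * ∫⁻ u in B, ‖p (x + u) - p x‖ₑ ^ 2) := by gcongr
      _ = (volume B)⁻¹ * ((volume B)⁻¹ * volume B) * ∫⁻ u in B, ‖p (x + u) - p x‖ₑ ^ 2 := by ring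
      _ = _ := by rw [ENNReal.inv_mul_cancel hB0 hfin, mul_one]
  calc ∫⁻ x, ‖smooth ε p x - p x‖ₑ ^ 2 * ‖p' x‖ₑ
      ≤ ∫⁻ x, (volume B)⁻¹ * ∫⁻ u in B, ‖p (x + u) - p x‖ₑ ^ 2 * ‖p' x‖ₑ := by
        refine lintegral_mono fun x => ?_
        rw [lintegral_mul_const _ (by fun_prop), ← mul_assoc]
        gcongr
        exact hpt x
    _ = (volume B)⁻¹ * ∫⁻ u in B, ∫⁻ x, ‖p (x + u) - p x‖ₑ ^ 2 * ‖p' x‖ₑ := by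
        rw [lintegral_const_mul' _ _ (ENNReal.inv_ne_top.2 hB0), lintegral_lintegral_swap]
        exact Measurable.aemeasurable (by fun_prop)
    _ ≤ (volume B)⁻¹ * ∫⁻ u in B, τ ^ 2 * eLpNorm p' 3 volume := by
        gcongr 1
        refine setLIntegral_mono measurable_const fun u hu => ?_
        refine (lintegral_enorm_sq_mul_enorm_le volume (by fun_prop) (by fun_prop)).trans ?_
        gcongr
        exact hτ u (by simpa [B] using hu)
    _ = _ := by
        rw [setLIntegral_const, mul_comm _ (volume B), ← mul_assoc,
          ENNReal.inv_mul_cancel hB0 hfin, one_mul]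

theorem measurable_smooth {p : Rd d → ℝ} (hp : Measurable p) (ε : ℝ) :
    Measurable (smooth ε p) := by
  unfold smooth
  refine Measurable.const_mul (StronglyMeasurable.measurable ?_) _
  exact StronglyMeasurable.integral_prod_right (f := fun x u => p (x + u))
    (Measurable.stronglyMeasurable (by fun_prop))

theorem integral_law_eq_toReal {p : Rd d → ℝ} (hp : Measurable p) (h0 : ∀ x, 0 ≤ p x)
    {f : Rd d → ℝ} (hf : Measurable f) :
    ∫ x, f x ^ 2 ∂law p = (∫⁻ x, ‖f x‖ₑ ^ 2 * ‖p x‖ₑ).toReal := by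
  rw [integral_law hp h0, integral_eq_lintegral_of_nonneg_ae
    (ae_of_all _ fun x => mul_nonneg (h0 x) (sq_nonneg _)) (by fun_prop)]
  congr 1
  refine lintegral_congr fun x => ?_
  rw [mul_comm, ENNReal.ofReal_mul (sq_nonneg _), ← Real.enorm_eq_ofReal (h0 x),
    ← Real.enorm_eq_ofReal (sq_nonneg (f x)), enorm_pow]

theorem tendsto_integral_smooth_sub_sq {p p' : Rd d → ℝ} (hp : Measurable p)
    (hpi : Integrable p) (hp3 : MemLp p 3 volume) (hp' : Measurable p') (h0' : ∀ x, 0 ≤ p' x)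
    (hp'3 : MemLp p' 3 volume) :
    Tendsto (fun ε => ∫ x, (smooth ε p x - p x) ^ 2 ∂law p') (𝓝[>] 0) (𝓝 0) := by
  have ht := tendsto_eLpNorm_translate_sub (by norm_num) (by norm_num) hp3
  have hlin : Tendsto (fun ε => ∫⁻ x, ‖smooth ε p x - p x‖ₑ ^ 2 * ‖p' x‖ₑ) (𝓝[>] 0) (𝓝 0) := by
    have hτ : Tendsto (fun τ : ℝ≥0∞ => τ ^ 2 * eLpNorm p' 3 volume) (𝓝 0) (𝓝 0) := by
      have h1 : Tendsto (fun τ : ℝ≥0∞ => τ ^ 2) (𝓝 0) (𝓝 0) := by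
        simpa using (ENNReal.continuous_pow 2).tendsto 0
      have := ENNReal.Tendsto.mul_const (b := eLpNorm p' 3 volume) h1
        (Or.inr hp'3.eLpNorm_ne_top)
      simpa using this
    rw [ENNReal.tendsto_nhds_zero]
    intro η hη
    obtain ⟨τ, hτ', hτη⟩ : ∃ τ : ℝ≥0∞, 0 < τ ∧ τ ^ 2 * eLpNorm p' 3 volume ≤ η := by
      have h1 := (ENNReal.tendsto_nhds_zero.1 hτ η hη)
      have h2 : ∀ᶠ τ : ℝ≥0∞ in 𝓝[>] 0, 0 < τ := eventually_mem_nhdsWithin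
      exact ((h2.and (h1.filter_mono nhdsWithin_le_nhds))).exists
    obtain ⟨ρ, hρ, hρτ⟩ := Metric.eventually_nhds_iff.1 (ENNReal.tendsto_nhds_zero.1 ht τ hτ')
    filter_upwards [Ioo_mem_nhdsGT hρ] with ε hε
    refine (lintegral_enorm_smooth_sub_sq_le hp hpi hp' hε.1 fun u hu => ?_).trans hτη
    exact hρτ (by simpa using hu.trans_lt hε.2)
  have := (ENNReal.tendsto_toReal ENNReal.zero_ne_top).comp hlin
  refine this.congr fun ε => ?_
  exact (integral_law_eq_toReal hp' h0' ((measurable_smooth hp ε).sub hp)).symm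

theorem memLp_two_law {p p' : Rd d → ℝ} (hp : Measurable p) (hp3 : MemLp p 3 volume)
    (hp' : Measurable p') (h0' : ∀ x, 0 ≤ p' x) (hp'3 : MemLp p' 3 volume) :
    MemLp p 2 (law p') := by
  refine ⟨hp.aestronglyMeasurable, ?_⟩
  rw [eLpNorm_lt_top_iff_lintegral_rpow_enorm_lt_top (by norm_num) (by norm_num), law,
    lintegral_withDensity_eq_lintegral_mul _ (by fun_prop) (by fun_prop)]
  have h := lintegral_enorm_sq_mul_enorm_le volume hp.aemeasurable hp'.aemeasurable
  refine lt_of_le_of_lt (le_trans (le_of_eq ?_) h)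
    (ENNReal.mul_lt_top (ENNReal.pow_lt_top hp3.eLpNorm_lt_top) hp'3.eLpNorm_lt_top)
  refine lintegral_congr fun x => ?_
  rw [Pi.mul_apply, ← Real.enorm_eq_ofReal (h0' x), mul_comm]
  simp

end Smoothing

/-! ### Second-order bound for the smoothing bias -/

section Bias

variable {d : ℕ}

theorem integral_translate_sub_sq_le {p : Rd d → ℝ} {α K : ℝ} (hK : 0 ≤ K) (hp : MemH2 α K p)
    {u : Rd d} (hu : ‖u‖ ≤ 1) : ∫ x, (p (x + u) - p x) ^ 2 ≤ (K * ‖u‖ ^ α) ^ 2 := by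
  have h := hp.2 (-u) (by simpa using hu)
  simp only [sub_neg_eq_add, norm_neg] at h
  exact (Real.sqrt_le_left (mul_nonneg hK (Real.rpow_nonneg (norm_nonneg _) _))).1 h

/-- By translation invariance this second difference is minus the integral of `(p (x + u) - p x) *
(p' (x + u) - p' x)`, so it is quadratic in the `L²` modulus of continuity. -/
theorem abs_integral_translate_add_sub_le {p p' : Rd d → ℝ} {α K : ℝ} (hα : 0 ≤ α) (hK : 0 ≤ K)
    (hp : MemH2 α K p) (hp' : MemH2 α K p') {ε : ℝ} (hε1 : ε ≤ 1) {u : Rd d} (hu : ‖u‖ ≤ ε) :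
    |(∫ x, p x * p' (x + u)) + (∫ x, p x * p' (x + -u)) - 2 * ∫ x, p x * p' x| ≤
      (K * ε ^ α) ^ 2 := by
  have hm : ∀ {f : Rd d → ℝ}, MemLp f 2 volume → MemLp (fun x => f (x + u)) 2 volume :=
    fun hf => hf.comp_measurePreserving (measurePreserving_add_right volume u)
  have hpu := hm hp.1
  have hpu' := hm hp'.1
  have e : ∫ x, p x * p' (x + -u) = ∫ x, p (x + u) * p' x := by
    rw [← integral_add_right_eq_self _ u]
    simp
  have e2 : ∫ x, p (x + u) * p' (x + u) = ∫ x, p x * p' x :=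
    integral_add_right_eq_self (fun x => p x * p' x) u
  have i1 : Integrable (fun x => p (x + u) * p' (x + u)) := hpu.integrable_mul hpu'
  have i2 : Integrable (fun x => p (x + u) * p' x) := hpu.integrable_mul hp'.1
  have i3 : Integrable (fun x => p x * p' (x + u)) := hp.1.integrable_mul hpu'
  have i4 : Integrable (fun x => p x * p' x) := hp.1.integrable_mul hp'.1
  have e3 : ∫ x, (p (x + u) - p x) * (p' (x + u) - p' x) =
      -((∫ x, p x * p' (x + u)) + (∫ x, p x * p' (x + -u)) - 2 * ∫ x, p x * p' x) := by
    have : ∀ x, (p (x + u) - p x) * (p' (x + u) - p' x) =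
        p (x + u) * p' (x + u) - p (x + u) * p' x - p x * p' (x + u) + p x * p' x := fun x => by
      ring
    simp_rw [this]
    have i12 : Integrable (fun x => p (x + u) * p' (x + u) - p (x + u) * p' x) := i1.sub i2
    have i123 : Integrable (fun x => p (x + u) * p' (x + u) - p (x + u) * p' x -
        p x * p' (x + u)) := i12.sub i3
    rw [integral_add i123 i4, integral_sub i12 i3, integral_sub i1 i2,
      e, e2]
    ring
  have hs : Integrable (fun x => (p (x + u) - p x) ^ 2) := (hpu.sub hp.1).integrable_sq
  have hs' : Integrable (fun x => (p' (x + u) - p' x) ^ 2) := (hpu'.sub hp'.1).integrable_sq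
  have hT : (K * ‖u‖ ^ α) ^ 2 ≤ (K * ε ^ α) ^ 2 := by gcongr
  have b1 := integral_translate_sub_sq_le hK hp (hu.trans hε1)
  have b2 := integral_translate_sub_sq_le hK hp' (hu.trans hε1)
  rw [← abs_neg, ← e3]
  calc _ ≤ ∫ x, |(p (x + u) - p x) * (p' (x + u) - p' x)| := abs_integral_le_integral_abs
    _ ≤ ∫ x, (1 / 2 * (p (x + u) - p x) ^ 2 + 1 / 2 * (p' (x + u) - p' x) ^ 2) := by
        refine integral_mono ((hpu.sub hp.1).integrable_mul (hpu'.sub hp'.1)).abs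
          ((hs.const_mul _).add (hs'.const_mul _)) fun x => ?_
        simp only [abs_mul]
        nlinarith [sq_nonneg (|p (x + u) - p x| - |p' (x + u) - p' x|),
          sq_abs (p (x + u) - p x), sq_abs (p' (x + u) - p' x)]
    _ = 1 / 2 * (∫ x, (p (x + u) - p x) ^ 2) + 1 / 2 * ∫ x, (p' (x + u) - p' x) ^ 2 := by
        rw [integral_add (hs.const_mul _) (hs'.const_mul _), integral_const_mul,
          integral_const_mul]
    _ ≤ _ := by linarith

/-- The smoothing bias of the quadratic functional is of second order in the smoothness. -/
theorem abs_integral_smooth_sub_le {p p' : Rd d → ℝ} (hpi : Integrable p)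
    (hpi' : Integrable p') {α K : ℝ} (hα : 0 ≤ α) (hK : 0 ≤ K) (hp : MemH2 α K p)
    (hp' : MemH2 α K p') {ε : ℝ} (hε : 0 < ε) (hε1 : ε ≤ 1) :
    |(∫ x, p x * smooth ε p' x) - ∫ x, p x * p' x| ≤ (K * ε ^ α) ^ 2 := by
  set B := Metric.closedBall (0 : Rd d) ε
  have hBm : MeasurableSet B := Metric.isClosed_closedBall.measurableSet
  have hBneg : ∀ u, -u ∈ B ↔ u ∈ B := fun u => by simp [B]
  have hfin : volume B ≠ ⊤ := measure_closedBall_lt_top.ne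
  have hb := ballVol_pos (d := d) hε
  set b := ballVol d ε with hbdef
  have hbB : volume.real B = b := rfl
  set c : Rd d → ℝ := fun u => ∫ x, p x * p' (x + u) with hc
  have hprod : Integrable (fun z : Rd d × Rd d => p z.1 * p' (z.1 + z.2))
      ((volume : Measure (Rd d)).prod volume) :=
    (measurePreserving_prod_add volume volume).integrable_comp_of_integrable (hpi.mul_prod hpi')
  have hprodB : Integrable (fun z : Rd d × Rd d => p z.1 * p' (z.1 + z.2))
      ((volume : Measure (Rd d)).prod (volume.restrict B)) := by
    refine hprod.mono_measure ?_
    exact Measure.prod_mono le_rfl Measure.restrict_le_self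
  have hcB : IntegrableOn c B := hprodB.integral_prod_right
  have hq : ∫ x, p x * smooth ε p' x = b⁻¹ * ∫ u in B, c u := by
    rw [hc, ← integral_integral_swap hprodB, ← integral_const_mul]
    refine integral_congr_ae (ae_of_all _ fun x => ?_)
    simp only [smooth]
    rw [integral_const_mul]
    ring
  -- The ball is symmetric, so the average of `c u` may be replaced by that of `(c u + c (-u)) / 2`,
  -- which brings in the second difference.
  have hneg : ∫ u in B, c (-u) = ∫ u in B, c u := by
    rw [← integral_indicator hBm, ← integral_indicator hBm, ← integral_neg_eq_self]
    refine integral_congr_ae (ae_of_all _ fun u => ?_)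
    classical
    simp only [Set.indicator_apply, hBneg, neg_neg]
  have hcnB : IntegrableOn (fun u => c (-u)) B := by
    have h := (integrable_indicator_iff hBm).2 hcB
    refine (integrable_indicator_iff hBm).1 (h.comp_neg.congr (ae_of_all _ fun u => ?_))
    classical
    simp only [Set.indicator_apply, hBneg]
  have hkey : 2 * b * ((∫ x, p x * smooth ε p' x) - ∫ x, p x * p' x) =
      ∫ u in B, (c u + c (-u) - 2 * ∫ x, p x * p' x) := by
    have hadd : IntegrableOn (fun u => c u + c (-u)) B := hcB.add hcnB
    rw [integral_sub hadd (integrableOn_const hfin), integral_add hcB hcnB, hneg,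
      setIntegral_const, hbB, hq, smul_eq_mul]
    field_simp
    ring
  have hle : |∫ u in B, (c u + c (-u) - 2 * ∫ x, p x * p' x)| ≤ (K * ε ^ α) ^ 2 * b := by
    rw [← Real.norm_eq_abs, ← hbB]
    refine norm_setIntegral_le_of_norm_le_const hfin.lt_top fun u hu => ?_
    exact abs_integral_translate_add_sub_le hα hK hp hp' hε1 (by simpa [B] using hu)
  rw [← hkey, abs_mul, abs_of_pos (by positivity)] at hle
  have h0 := abs_nonneg ((∫ x, p x * smooth ε p' x) - ∫ x, p x * p' x)
  nlinarith

end Bias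

/-! ### Two-sample model and its smoothed quantities -/

section Sample

theorem StrictlyStationary.comp {Ω S T : Type*} [MeasurableSpace Ω] [MeasurableSpace S]
    [MeasurableSpace T] {μ : Measure Ω} {W : ℕ → Ω → S} (h : StrictlyStationary μ W) {φ : S → T}
    (hφ : Measurable φ) : StrictlyStationary μ (fun i ω => φ (W i ω)) := fun r k =>
  (h r k).comp (u := fun v i => φ (v i)) (by fun_prop)

theorem MDependent.comp {Ω S T : Type*} [MeasurableSpace Ω] [MeasurableSpace S]
    [MeasurableSpace T] {μ : Measure Ω} {m : ℕ} {W : ℕ → Ω → S} (h : MDependent μ m W) {φ : S → T}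
    (hφ : Measurable φ) : MDependent μ m (fun i ω => φ (W i ω)) := fun b k l hk =>
  (h b k l hk).comp (φ := fun (v : Fin (b + 1) → S) i => φ (v i))
    (ψ := fun (v : Fin (l + 1) → S) i => φ (v i)) (by fun_prop) (by fun_prop)

/-- A stationary `m`-dependent sequence of pairs whose marginals have densities in `L₃`. -/
structure Sample {Ω : Type*} [MeasurableSpace Ω] {d : ℕ} (μ : Measure Ω) (m : ℕ)
    (X Y : ℕ → Ω → Rd d) (pX pY : Rd d → ℝ) : Prop where
  measX : ∀ i, Measurable (X i)
  measY : ∀ i, Measurable (Y i)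
  stat : StrictlyStationary μ (fun i ω => (X i ω, Y i ω))
  dep : MDependent μ m (fun i ω => (X i ω, Y i ω))
  densX : IsDensity μ (X 0) pX
  densY : IsDensity μ (Y 0) pY
  memX : MemLp pX 3 volume
  memY : MemLp pY 3 volume

/-- The linear part of the estimator of `∫ pX * pY`. -/
noncomputable def linPart {Ω : Type*} {d : ℕ} (X Y : ℕ → Ω → Rd d) (pX pY : Rd d → ℝ) (n : ℕ)
    (ω : Ω) : ℝ :=
  (n : ℝ)⁻¹ * ∑ i ∈ Finset.range n, (pY (X i ω) + pX (Y i ω) - 2 * ∫ x, pX x * pY x)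

/-- The smoothing bias for the functional `∫ pX * pY`. -/
noncomputable def bias {d : ℕ} (pX pY : Rd d → ℝ) (ε : ℝ) : ℝ :=
  (∫ x, pX x * smooth ε pY x) - ∫ x, pX x * pY x

/-- Bound for the second moments of the centred smoothing errors. -/
noncomputable def smoothErr {d : ℕ} (pX pY : Rd d → ℝ) (ε : ℝ) : ℝ :=
  3 * (∫ x, (smooth ε pY x - pY x) ^ 2 ∂law pX) + 3 * (∫ x, (smooth ε pX x - pX x) ^ 2 ∂law pY) +
    12 * bias pX pY ε ^ 2

variable {Ω : Type*} [MeasurableSpace Ω] {d : ℕ} {μ : Measure Ω} {m : ℕ}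
  {X Y : ℕ → Ω → Rd d} {pX pY : Rd d → ℝ}

namespace Sample

/-- The one-sample problem is the two-sample problem with `Y = X`; this is legitimate because `X i`
and `Y i` need not be independent. -/
theorem diag_left (H : Sample μ m X Y pX pY) : Sample μ m X X pX pX :=
  ⟨H.measX, H.measX, H.stat.comp (φ := fun z => (z.1, z.1)) (by fun_prop),
    H.dep.comp (φ := fun z => (z.1, z.1)) (by fun_prop), H.densX, H.densX, H.memX, H.memX⟩

theorem swap (H : Sample μ m X Y pX pY) : Sample μ m Y X pY pX :=
  ⟨H.measY, H.measX, H.stat.comp (φ := Prod.swap) measurable_swap,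
    H.dep.comp (φ := Prod.swap) measurable_swap, H.densY, H.densX, H.memY, H.memX⟩

theorem mpX (H : Sample μ m X Y pX pY) (i : ℕ) : MeasurePreserving (X i) μ (law pX) := by
  refine ⟨H.measX i, ?_⟩
  have h := ((H.stat.identDistrib i).comp measurable_fst).map_eq
  simp only [Function.comp_def] at h
  rw [← h]
  exact H.densX.2.2

theorem mpY (H : Sample μ m X Y pX pY) (i : ℕ) : MeasurePreserving (Y i) μ (law pY) :=
  H.swap.mpX i

theorem integral_compX (H : Sample μ m X Y pX pY) (i : ℕ) {f : Rd d → ℝ} (hf : Measurable f) :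
    ∫ ω, f (X i ω) ∂μ = ∫ x, f x ∂law pX := by
  rw [← (H.mpX i).map_eq, integral_map (H.measX i).aemeasurable hf.aestronglyMeasurable]

theorem integral_law_Y (H : Sample μ m X Y pX pY) : ∫ x, pY x ∂law pX = ∫ x, pX x * pY x :=
  integral_law H.densX.1 H.densX.2.1 _

theorem memLpY (H : Sample μ m X Y pX pY) : MemLp pY 2 (law pX) :=
  memLp_two_law H.densY.1 H.memY H.densX.1 H.densX.2.1 H.memX

theorem integral_smooth_law (H : Sample μ m X Y pX pY) (ε : ℝ) :
    ∫ x, smooth ε pY x ∂law pX = bias pX pY ε + ∫ x, pX x * pY x := by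
  rw [integral_law H.densX.1 H.densX.2.1, bias, sub_add_cancel]

variable [IsProbabilityMeasure μ]

theorem isProbX (H : Sample μ m X Y pX pY) : IsProbabilityMeasure (law pX) :=
  (H.mpX 0).map_eq ▸ Measure.isProbabilityMeasure_map (H.measX 0).aemeasurable

theorem integrableX (H : Sample μ m X Y pX pY) : Integrable pX := by
  have := H.isProbX
  have h := measure_ne_top (law pX) Set.univ
  rw [law, withDensity_apply _ MeasurableSet.univ, Measure.restrict_univ] at h
  exact (lintegral_ofReal_ne_top_iff_integrable H.densX.1.aestronglyMeasurable
    (ae_of_all _ H.densX.2.1)).1 h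

theorem smooth_mem_Icc (H : Sample μ m X Y pX pY) {ε : ℝ} (hε : 0 < ε) (x : Rd d) :
    0 ≤ smooth ε pX x ∧ smooth ε pX x ≤ (ballVol d ε)⁻¹ := by
  have hb := ballVol_pos (d := d) hε
  have := H.isProbX
  have h0 : ∀ y, 0 ≤ close ε x y / ballVol d ε := fun y => by unfold close; split_ifs <;> positivity
  have h1 : ∀ y, close ε x y / ballVol d ε ≤ (ballVol d ε)⁻¹ := fun y => by
    unfold close; split_ifs
    · simp
    · simpa using hb.le
  rw [← integral_close_law H.densX.1 H.densX.2.1]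
  refine ⟨integral_nonneg h0, ?_⟩
  have := integral_mono_of_nonneg (μ := law pX) (ae_of_all _ h0)
    (integrable_const (ballVol d ε)⁻¹) (ae_of_all _ h1)
  simpa using this

theorem memLp_smooth (H : Sample μ m X Y pX pY) {ε : ℝ} (hε : 0 < ε) (ν : Measure (Rd d))
    [IsFiniteMeasure ν] : MemLp (smooth ε pX) 2 ν :=
  MemLp.of_bound (measurable_smooth H.densX.1 ε).aestronglyMeasurable (ballVol d ε)⁻¹
    (ae_of_all _ fun x => by
      rw [Real.norm_eq_abs, abs_of_nonneg (H.smooth_mem_Icc hε x).1]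
      exact (H.smooth_mem_Icc hε x).2)

/-- Both sides integrate the same symmetric kernel against the product of the two laws. -/
theorem integral_smooth_law_swap (H : Sample μ m X Y pX pY) (ε : ℝ) :
    ∫ y, smooth ε pX y ∂law pY = ∫ x, smooth ε pY x ∂law pX := by
  have := H.isProbX
  have := H.swap.isProbX
  have hm := measurable_close (d := d) ε
  simp_rw [← integral_close_law H.densX.1 H.densX.2.1, ← integral_close_law H.densY.1 H.densY.2.1]
  have hi : Integrable (Function.uncurry fun y x : Rd d => close ε y x / ballVol d ε)
      ((law pY).prod (law pX)) := by
    refine Integrable.of_bound (C := |(ballVol d ε)⁻¹|)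
      (hm.div_const _).aestronglyMeasurable (ae_of_all _ fun z => ?_)
    simp only [Function.uncurry, close, Real.norm_eq_abs]
    split_ifs
    · simp
    · simp
  rw [integral_integral_swap hi]
  simp_rw [close_comm ε]

theorem bias_comm (H : Sample μ m X Y pX pY) (ε : ℝ) : bias pY pX ε = bias pX pY ε := by
  have h := H.integral_smooth_law_swap ε
  rw [H.integral_smooth_law, H.swap.integral_smooth_law] at h
  simp_rw [mul_comm (pY _)] at h
  linarith

/-- The bias is the mean of `smooth ε pY - pY` under `law pX`, and a squared mean is at most the
second moment. -/
theorem bias_sq_le (H : Sample μ m X Y pX pY) {ε : ℝ} (hε : 0 < ε) :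
    bias pX pY ε ^ 2 ≤ ∫ x, (smooth ε pY x - pY x) ^ 2 ∂law pX := by
  have := H.isProbX
  have hL : MemLp (fun x => smooth ε pY x - pY x) 2 (law pX) :=
    (H.swap.memLp_smooth hε _).sub H.memLpY
  have hb : bias pX pY ε = ∫ x, (smooth ε pY x - pY x) ∂law pX := by
    rw [integral_sub ((H.swap.memLp_smooth hε _).integrable one_le_two)
      (H.memLpY.integrable one_le_two), H.integral_smooth_law, H.integral_law_Y]
    ring
  have hv := variance_nonneg (fun x => smooth ε pY x - pY x) (law pX)
  rw [variance_eq_sub hL] at hv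
  rw [hb]
  simpa using hv

theorem tendsto_smooth_sq (H : Sample μ m X Y pX pY) :
    Tendsto (fun ε => ∫ x, (smooth ε pY x - pY x) ^ 2 ∂law pX) (𝓝[>] 0) (𝓝 0) :=
  tendsto_integral_smooth_sub_sq H.densY.1 H.swap.integrableX H.memY H.densX.1 H.densX.2.1 H.memX

theorem tendsto_bias_sq (H : Sample μ m X Y pX pY) :
    Tendsto (fun ε => bias pX pY ε ^ 2) (𝓝[>] 0) (𝓝 0) := by
  refine tendsto_of_tendsto_of_tendsto_of_le_of_le' tendsto_const_nhds H.tendsto_smooth_sq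
    (Eventually.of_forall fun ε => sq_nonneg _) ?_
  filter_upwards [self_mem_nhdsWithin] with ε hε using H.bias_sq_le hε

theorem tendsto_smoothErr (H : Sample μ m X Y pX pY) :
    Tendsto (smoothErr pX pY) (𝓝[>] 0) (𝓝 0) := by
  have := ((H.tendsto_smooth_sq.const_mul 3).add (H.swap.tendsto_smooth_sq.const_mul 3)).add
    (H.tendsto_bias_sq.const_mul 12)
  simp only [mul_zero, add_zero] at this
  exact this

end Sample

end Sample

/-! ### Terms of the Hoeffding decomposition -/

section Expansion

variable {Ω : Type*} [MeasurableSpace Ω] {d : ℕ} {μ : Measure Ω} {m : ℕ}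
  {X Y : ℕ → Ω → Rd d} {pX pY : Rd d → ℝ}

namespace Sample

theorem integral_mul_eq_zero (H : Sample μ m X Y pX pY) {F : Rd d × Rd d → ℝ} (hF : Measurable F)
    (h0 : ∀ i, ∫ ω, F (X i ω, Y i ω) ∂μ = 0) {i j : ℕ} (hij : i + m < j) :
    ∫ ω, F (X i ω, Y i ω) * F (X j ω, Y j ω) ∂μ = 0 := by
  have hX := H.measX
  have hY := H.measY
  have h := (H.dep.indepFun hij).comp hF hF
  have := h.integral_fun_mul_eq_mul_integral (hF.comp (by fun_prop)).aestronglyMeasurable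
    (hF.comp (by fun_prop)).aestronglyMeasurable
  simp only [Function.comp_def] at this
  rw [this, h0, zero_mul]

theorem integral_mul_eq (H : Sample μ m X Y pX pY) {F : Rd d × Rd d → ℝ} (hF : Measurable F)
    (i j : ℕ) : ∫ ω, F (X i ω, Y i ω) * F (X j ω, Y j ω) ∂μ =
      ∫ ω, F (X 0 ω, Y 0 ω) * F (X (i - j + (j - i)) ω, Y (i - j + (j - i)) ω) ∂μ := by
  have key : ∀ i h, ∫ ω, F (X i ω, Y i ω) * F (X (h + i) ω, Y (h + i) ω) ∂μ =
      ∫ ω, F (X 0 ω, Y 0 ω) * F (X h ω, Y h ω) ∂μ := fun i h => by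
    have := ((H.stat.identDistrib_pair 0 h i).comp
      (u := fun z => F z.1 * F z.2) (by fun_prop)).integral_eq
    simpa [Function.comp_def] using this.symm
  rcases le_total i j with h | h
  · have e1 : i - j + (j - i) = j - i := by omega
    have e2 : j - i + i = j := by omega
    rw [e1, ← key i, e2]
  · have e1 : i - j + (j - i) = i - j := by omega
    have e2 : i - j + j = i := by omega
    rw [e1, ← key j, e2]
    simp_rw [mul_comm]

theorem integral_pY_X (H : Sample μ m X Y pX pY) (i : ℕ) :
    ∫ ω, pY (X i ω) ∂μ = ∫ x, pX x * pY x := by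
  rw [H.integral_compX i H.densY.1, H.integral_law_Y]

/-- The completely degenerate part of the kernel `close ε / ballVol d ε`. -/
noncomputable def _root_.QuadDensity.degKernel (pX pY : Rd d → ℝ) (ε : ℝ) (z : Rd d × Rd d) : ℝ :=
  close ε z.1 z.2 / ballVol d ε - smooth ε pY z.1 - smooth ε pX z.2 +
    (bias pX pY ε + ∫ x, pX x * pY x)

theorem measurable_degKernel (H : Sample μ m X Y pX pY) (ε : ℝ) :
    Measurable (degKernel pX pY ε) :=
  ((((measurable_close ε).div_const _).sub
    ((measurable_smooth H.densY.1 ε).comp measurable_fst)).sub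
    ((measurable_smooth H.densX.1 ε).comp measurable_snd)).add_const _

/-- The centred error of replacing the densities by their smoothed versions in `linPart`. -/
noncomputable def _root_.QuadDensity.smoothRem (pX pY : Rd d → ℝ) (ε : ℝ) (z : Rd d × Rd d) : ℝ :=
  (smooth ε pY z.1 - pY z.1) + (smooth ε pX z.2 - pX z.2) - 2 * bias pX pY ε

theorem measurable_smoothRem (H : Sample μ m X Y pX pY) (ε : ℝ) :
    Measurable (smoothRem pX pY ε) := by
  have h1 := measurable_smooth H.densX.1 ε
  have h2 := measurable_smooth H.densY.1 ε
  have h3 := H.densX.1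
  have h4 := H.densY.1
  unfold smoothRem
  fun_prop

theorem integral_pX_Y (H : Sample μ m X Y pX pY) (i : ℕ) :
    ∫ ω, pX (Y i ω) ∂μ = ∫ x, pX x * pY x := by
  rw [H.swap.integral_pY_X]
  simp_rw [mul_comm]

variable [IsProbabilityMeasure μ]

theorem memLp_summand (H : Sample μ m X Y pX pY) (i : ℕ) :
    MemLp (fun ω => pY (X i ω) + pX (Y i ω) - 2 * ∫ x, pX x * pY x) 2 μ :=
  ((H.memLpY.comp_measurePreserving (H.mpX i)).add
    (H.swap.memLpY.comp_measurePreserving (H.mpY i))).sub (memLp_const _)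

theorem integrable_pY_X (H : Sample μ m X Y pX pY) (i : ℕ) :
    Integrable (fun ω => pY (X i ω)) μ :=
  (H.memLpY.comp_measurePreserving (H.mpX i)).integrable one_le_two

theorem integral_summand (H : Sample μ m X Y pX pY) (i : ℕ) :
    ∫ ω, (pY (X i ω) + pX (Y i ω) - 2 * ∫ x, pX x * pY x) ∂μ = 0 := by
  have h : Integrable (fun ω => pY (X i ω) + pX (Y i ω)) μ :=
    (H.integrable_pY_X i).add (H.swap.integrable_pY_X i)
  rw [integral_sub h (integrable_const _),
    integral_add (H.integrable_pY_X i) (H.swap.integrable_pY_X i), H.integral_pY_X,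
    H.integral_pX_Y]
  simp
  ring

theorem memLp_linPart (H : Sample μ m X Y pX pY) (n : ℕ) : MemLp (linPart X Y pX pY n) 2 μ :=
  (memLp_finsetSum (Finset.range n) fun i _ => H.memLp_summand i).const_mul _

/-- The summand is twice the centred `(pY (X i) + pX (Y i)) / 2`, which is the source of the factor
`4`. -/
theorem tendsto_mul_integral_linPart_sq (H : Sample μ m X Y pX pY) :
    Tendsto (fun n : ℕ => (n : ℝ) * ∫ ω, linPart X Y pX pY n ω ^ 2 ∂μ) atTop
      (𝓝 (4 * longRunVar μ m (fun i ω => (1 / 2 : ℝ) * (pY (X i ω) + pX (Y i ω))))) := by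
  set Q := ∫ x, pX x * pY x with hQ
  set F : Rd d × Rd d → ℝ := fun z => pY z.1 + pX z.2 - 2 * Q with hF
  have hXm := H.densX.1
  have hYm := H.densY.1
  have hFm : Measurable F := by fun_prop
  set γ : ℕ → ℝ := fun h => ∫ ω, F (X 0 ω, Y 0 ω) * F (X h ω, Y h ω) ∂μ with hγ
  have hγ0 : ∀ h, m < h → γ h = 0 := fun h hh =>
    H.integral_mul_eq_zero hFm H.integral_summand (by simpa using hh)
  have hmean : ∀ i, ∫ ω, (1 / 2 : ℝ) * (pY (X i ω) + pX (Y i ω)) ∂μ = Q := fun i => by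
    rw [integral_const_mul, integral_add (H.integrable_pY_X i) (H.swap.integrable_pY_X i),
      H.integral_pY_X, H.integral_pX_Y]
    ring
  have hcov : ∀ h, 4 * covariance (fun ω => (1 / 2 : ℝ) * (pY (X 0 ω) + pX (Y 0 ω)))
      (fun ω => (1 / 2 : ℝ) * (pY (X h ω) + pX (Y h ω))) μ = γ h := fun h => by
    rw [covariance, hmean, hmean, ← integral_const_mul]
    refine integral_congr_ae (ae_of_all _ fun ω => ?_)
    simp only [hF]
    ring
  have hlim : 4 * longRunVar μ m (fun i ω => (1 / 2 : ℝ) * (pY (X i ω) + pX (Y i ω))) =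
      γ 0 + 2 * ∑ h ∈ Finset.Icc 1 m, γ h := by
    have hv : variance (fun ω => (1 / 2 : ℝ) * (pY (X 0 ω) + pX (Y 0 ω))) μ =
        covariance (fun ω => (1 / 2 : ℝ) * (pY (X 0 ω) + pX (Y 0 ω)))
          (fun ω => (1 / 2 : ℝ) * (pY (X 0 ω) + pX (Y 0 ω))) μ := by
      refine (covariance_self ?_).symm
      exact (((hYm.comp (H.measX 0)).add (hXm.comp (H.measY 0))).const_mul _).aemeasurable
    simp_rw [← hcov, longRunVar, hv, ← Finset.mul_sum]
    ring
  rw [hlim]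
  refine (tendsto_sum_sum_div γ m hγ0).congr' ?_
  filter_upwards [eventually_ge_atTop 1] with n hn
  have hn0 : (n : ℝ) ≠ 0 := by positivity
  have hsum := integral_sum_sq (μ := μ) H.memLp_summand n
  simp only [linPart, mul_pow]
  rw [integral_const_mul, hsum, ← mul_assoc]
  have e : (n : ℝ) * (n : ℝ)⁻¹ ^ 2 = (n : ℝ)⁻¹ := by field_simp
  rw [e]
  congr 1
  exact Finset.sum_congr rfl fun i _ => Finset.sum_congr rfl fun j _ =>
    (H.integral_mul_eq hFm i j).symm

theorem integrable_close (H : Sample μ m X Y pX pY) (ε : ℝ) (x : Rd d) :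
    Integrable (fun y => close ε x y / ballVol d ε) (law pY) := by
  have := H.swap.isProbX
  refine Integrable.of_bound (C := |(ballVol d ε)⁻¹|)
    (((measurable_close ε).comp (by fun_prop : Measurable fun y => (x, y))).div_const
      _).aestronglyMeasurable (ae_of_all _ fun z => ?_)
  simp only [close, Real.norm_eq_abs]
  split_ifs <;> simp

theorem integral_degKernel_right (H : Sample μ m X Y pX pY) {ε : ℝ} (hε : 0 < ε) (x : Rd d) :
    ∫ y, degKernel pX pY ε (x, y) ∂law pY = 0 := by
  have := H.swap.isProbX
  have i1 := H.integrable_close ε x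
  have i2 : Integrable (fun y => close ε x y / ballVol d ε - smooth ε pY x) (law pY) :=
    i1.sub (integrable_const _)
  have i3 : Integrable (smooth ε pX) (law pY) := (H.memLp_smooth hε _).integrable one_le_two
  have i4 : Integrable (fun y => close ε x y / ballVol d ε - smooth ε pY x - smooth ε pX y)
    (law pY) := i2.sub i3
  simp only [degKernel]
  rw [integral_add i4 (integrable_const _), integral_sub i2 i3, integral_sub i1
    (integrable_const _), integral_close_law H.densY.1 H.densY.2.1, H.integral_smooth_law_swap,
    H.integral_smooth_law]
  simp

theorem degKernel_swap (H : Sample μ m X Y pX pY) (ε : ℝ) (x y : Rd d) :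
    degKernel pX pY ε (x, y) = degKernel pY pX ε (y, x) := by
  simp only [degKernel]
  rw [H.bias_comm, close_comm]
  simp_rw [mul_comm (pX _)]
  ring

theorem integral_degKernel_left (H : Sample μ m X Y pX pY) {ε : ℝ} (hε : 0 < ε) (y : Rd d) :
    ∫ x, degKernel pX pY ε (x, y) ∂law pX = 0 := by
  simp_rw [H.degKernel_swap]
  exact H.swap.integral_degKernel_right hε y

/-- The kernel is a combination of four quantities in `[0, (ballVol d ε)⁻¹]`, two with each sign. -/
theorem abs_degKernel_le (H : Sample μ m X Y pX pY) {ε : ℝ} (hε : 0 < ε) (z : Rd d × Rd d) :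
    |degKernel pX pY ε z| ≤ 2 * (ballVol d ε)⁻¹ := by
  have hb := ballVol_pos (d := d) hε
  have := H.isProbX
  have h1 := H.smooth_mem_Icc hε z.2
  have h2 := H.swap.smooth_mem_Icc hε z.1
  have h3 : 0 ≤ close ε z.1 z.2 / ballVol d ε ∧
      close ε z.1 z.2 / ballVol d ε ≤ (ballVol d ε)⁻¹ := by
    unfold close
    split_ifs
    · simpa using hb.le
    · simpa using hb.le
  have h4 : 0 ≤ bias pX pY ε + ∫ x, pX x * pY x ∧
      bias pX pY ε + ∫ x, pX x * pY x ≤ (ballVol d ε)⁻¹ := by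
    rw [← H.integral_smooth_law]
    refine ⟨integral_nonneg fun x => (H.swap.smooth_mem_Icc hε x).1, ?_⟩
    have := integral_mono_of_nonneg (μ := law pX)
      (ae_of_all _ fun x => (H.swap.smooth_mem_Icc hε x).1)
      (integrable_const (ballVol d ε)⁻¹) (ae_of_all _ fun x => (H.swap.smooth_mem_Icc hε x).2)
    simpa using this
  rw [abs_le, degKernel]
  constructor <;> linarith [h1.1, h1.2, h2.1, h2.2, h3.1, h3.2, h4.1, h4.2]

theorem memLp_smooth_sub (H : Sample μ m X Y pX pY) {ε : ℝ} (hε : 0 < ε) (i : ℕ) :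
    MemLp (fun ω => smooth ε pY (X i ω) - pY (X i ω)) 2 μ := by
  have := H.isProbX
  exact ((H.swap.memLp_smooth hε (law pX)).sub H.memLpY).comp_measurePreserving (H.mpX i)

theorem memLp_smoothRem (H : Sample μ m X Y pX pY) {ε : ℝ} (hε : 0 < ε) (i : ℕ) :
    MemLp (fun ω => smoothRem pX pY ε (X i ω, Y i ω)) 2 μ :=
  ((H.memLp_smooth_sub hε i).add (H.swap.memLp_smooth_sub hε i)).sub (memLp_const _)

theorem integral_smooth_sub (H : Sample μ m X Y pX pY) {ε : ℝ} (hε : 0 < ε) (i : ℕ) :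
    ∫ ω, (smooth ε pY (X i ω) - pY (X i ω)) ∂μ = bias pX pY ε := by
  have := H.isProbX
  rw [H.integral_compX i (f := fun x => smooth ε pY x - pY x)
    ((measurable_smooth H.densY.1 ε).sub H.densY.1),
    integral_sub ((H.swap.memLp_smooth hε _).integrable one_le_two)
      (H.memLpY.integrable one_le_two), H.integral_smooth_law, H.integral_law_Y]
  ring

theorem integral_smoothRem (H : Sample μ m X Y pX pY) {ε : ℝ} (hε : 0 < ε) (i : ℕ) :
    ∫ ω, smoothRem pX pY ε (X i ω, Y i ω) ∂μ = 0 := by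
  have h1 := (H.memLp_smooth_sub hε i).integrable one_le_two
  have h2 := (H.swap.memLp_smooth_sub hε i).integrable one_le_two
  simp only [smoothRem]
  have h12 : Integrable (fun ω => smooth ε pY (X i ω) - pY (X i ω) +
      (smooth ε pX (Y i ω) - pX (Y i ω))) μ := h1.add h2
  rw [integral_sub h12 (integrable_const _), integral_add h1 h2,
    H.integral_smooth_sub hε, H.swap.integral_smooth_sub hε, H.bias_comm]
  simp
  ring

theorem integral_smoothRem_sq_le (H : Sample μ m X Y pX pY) {ε : ℝ} (hε : 0 < ε) (i : ℕ) :
    ∫ ω, smoothRem pX pY ε (X i ω, Y i ω) ^ 2 ∂μ ≤ smoothErr pX pY ε := by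
  have h1 := (H.memLp_smooth_sub hε i).integrable_sq.const_mul 3
  have h2 := (H.swap.memLp_smooth_sub hε i).integrable_sq.const_mul 3
  have e1 : ∫ ω, (smooth ε pY (X i ω) - pY (X i ω)) ^ 2 ∂μ =
      ∫ x, (smooth ε pY x - pY x) ^ 2 ∂law pX :=
    H.integral_compX i (f := fun x => (smooth ε pY x - pY x) ^ 2)
      (((measurable_smooth H.densY.1 ε).sub H.densY.1).pow_const 2)
  have e2 : ∫ ω, (smooth ε pX (Y i ω) - pX (Y i ω)) ^ 2 ∂μ =
      ∫ x, (smooth ε pX x - pX x) ^ 2 ∂law pY :=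
    H.swap.integral_compX i (f := fun x => (smooth ε pX x - pX x) ^ 2)
      (((measurable_smooth H.densX.1 ε).sub H.densX.1).pow_const 2)
  calc _ ≤ ∫ ω, (3 * (smooth ε pY (X i ω) - pY (X i ω)) ^ 2 +
        3 * (smooth ε pX (Y i ω) - pX (Y i ω)) ^ 2 + 12 * bias pX pY ε ^ 2) ∂μ := by
        refine integral_mono (H.memLp_smoothRem hε i).integrable_sq
          ((h1.add h2).add (integrable_const _)) fun ω => ?_
        simp only [smoothRem]
        set a := smooth ε pY (X i ω) - pY (X i ω)
        set b := smooth ε pX (Y i ω) - pX (Y i ω)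
        set c := bias pX pY ε
        -- This is `(a + b - 2 * c) ^ 2 ≤ 3 * (a ^ 2 + b ^ 2 + 4 * c ^ 2)`, the origin of the
        -- constants in `smoothErr`.
        nlinarith [sq_nonneg (a - b), sq_nonneg (a + 2 * c), sq_nonneg (b + 2 * c)]
    _ = _ := by
        have h12 : Integrable (fun ω => 3 * (smooth ε pY (X i ω) - pY (X i ω)) ^ 2 +
            3 * (smooth ε pX (Y i ω) - pX (Y i ω)) ^ 2) μ := h1.add h2
        rw [integral_add h12 (integrable_const _), integral_add h1 h2,
          integral_const_mul, integral_const_mul, e1, e2, smoothErr]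
        simp

end Sample

end Expansion

/-! ### Linear part plus remainder for both kinds of statistic -/

section MeanSquare

theorem two_mul_sum_close_add {Ω : Type*} {d : ℕ} (X : ℕ → Ω → Rd d) (n : ℕ) {ε : ℝ} (hε : 0 ≤ ε) (ω : Ω) :
    2 * ∑ j ∈ Finset.range n, ∑ i ∈ Finset.range j, close ε (X i ω) (X j ω) + n =
      ∑ i ∈ Finset.range n, ∑ j ∈ Finset.range n, close ε (X i ω) (X j ω) := by
  induction n with
  | zero => simp
  | succ n ih =>
    have h1 : close ε (X n ω) (X n ω) = 1 := by simp [close, hε]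
    simp_rw [Finset.sum_range_succ, Finset.sum_add_distrib] at ih ⊢
    rw [← ih, h1, Finset.sum_congr rfl fun j _ => close_comm ε (X n ω) (X j ω)]
    push_cast
    ring

/-- The full double sum counts each pair twice and adds `n` diagonal terms, each equal to one. -/
theorem Qone_eq {Ω : Type*} {d : ℕ} (X : ℕ → Ω → Rd d) {n : ℕ} (hn : 2 ≤ n) {ε : ℝ} (hε : 0 ≤ ε) (ω : Ω) :
    Qone X n ε ω = (n * Qtwo X X n ε ω - 1) / (n - 1) := by
  have hn1 : (2 : ℝ) ≤ n := by exact_mod_cast hn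
  have hn2 : (n : ℝ) - 1 ≠ 0 := by linarith
  have hn3 : (n : ℝ) ≠ 0 := by linarith
  have h := two_mul_sum_close_add X n hε ω
  rw [Qone, Qtwo, ← h, Nat.cast_choose_two]
  field_simp
  ring

variable {Ω : Type*} [MeasurableSpace Ω] {d : ℕ} {μ : Measure Ω} {m : ℕ}
  {X Y : ℕ → Ω → Rd d} {pX pY p : Rd d → ℝ}

theorem integral_add_add_sq_le {f g h : Ω → ℝ} (hf : MemLp f 2 μ) (hg : MemLp g 2 μ)
    (hh : MemLp h 2 μ) : ∫ ω, (f ω + g ω + h ω) ^ 2 ∂μ ≤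
      3 * ((∫ ω, f ω ^ 2 ∂μ) + (∫ ω, g ω ^ 2 ∂μ) + ∫ ω, h ω ^ 2 ∂μ) := by
  have h12 : Integrable (fun ω => f ω ^ 2 + g ω ^ 2) μ := hf.integrable_sq.add hg.integrable_sq
  rw [← integral_add hf.integrable_sq hg.integrable_sq, ← integral_add h12 hh.integrable_sq,
    ← integral_const_mul]
  refine integral_mono ((hf.add hg).add hh).integrable_sq
    ((h12.add hh.integrable_sq).const_mul 3) fun ω => ?_
  simp only
  nlinarith [sq_nonneg (f ω - g ω), sq_nonneg (f ω - h ω), sq_nonneg (g ω - h ω)]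

variable [IsProbabilityMeasure μ]

/-- Decomposition of the normalized two-sample statistic into its linear part and a remainder. -/
theorem Sample.exists_remainder (H : Sample μ m X Y pX pY) {n : ℕ} (hn : 1 ≤ n) {ε : ℝ}
    (hε : 0 < ε) :
    ∃ R : Ω → ℝ, MemLp R 2 μ ∧
      (∀ ω, Qtwo X Y n ε ω / ballVol d ε - ∫ x, pX x * pY x = linPart X Y pX pY n ω + R ω) ∧
      ∫ ω, R ω ^ 2 ∂μ ≤ 3 * (12 * (4 * m + 1) ^ 2 * (1 / (n * ballVol d ε) ^ 2) +
        (2 * m + 1) * (smoothErr pX pY ε / n) + bias pX pY ε ^ 2) := by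
  have hn0 : (n : ℝ) ≠ 0 := by positivity
  have hX := H.measX
  have hY := H.measY
  have hb := ballVol_pos (d := d) hε
  set D : Ω → ℝ := fun ω => ((n : ℝ) ^ 2)⁻¹ *
    ∑ i ∈ Finset.range n, ∑ j ∈ Finset.range n, degKernel pX pY ε (X i ω, Y j ω) with hD
  set T : Ω → ℝ := fun ω => (n : ℝ)⁻¹ *
    ∑ i ∈ Finset.range n, smoothRem pX pY ε (X i ω, Y i ω) with hT
  have hdm := H.measurable_degKernel ε
  have hDL : MemLp D 2 μ := by
    have hij : ∀ i j, MemLp (fun ω => degKernel pX pY ε (X i ω, Y j ω)) 2 μ := fun i j =>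
      MemLp.of_bound (hdm.comp ((hX i).prodMk (hY j))).aestronglyMeasurable
        (2 * (ballVol d ε)⁻¹) (ae_of_all _ fun ω => by
          rw [Real.norm_eq_abs]; exact H.abs_degKernel_le hε (X i ω, Y j ω))
    have hi : ∀ i, MemLp (fun ω => ∑ j ∈ Finset.range n, degKernel pX pY ε (X i ω, Y j ω)) 2 μ :=
      fun i => memLp_finsetSum (f := fun j ω => degKernel pX pY ε (X i ω, Y j ω)) _
        fun j _ => hij i j
    exact (memLp_finsetSum (f := fun i ω => ∑ j ∈ Finset.range n,
      degKernel pX pY ε (X i ω, Y j ω)) _ fun i _ => hi i).const_mul _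
  have hTL : MemLp T 2 μ := (memLp_finsetSum
    (f := fun i ω => smoothRem pX pY ε (X i ω, Y i ω)) _ fun i _ => H.memLp_smoothRem hε i).const_mul _
  have hD2 : ∫ ω, D ω ^ 2 ∂μ ≤ 12 * (4 * m + 1) ^ 2 * (1 / (n * ballVol d ε) ^ 2) := by
    have h := integral_sum_degenerate_sq_le hX hY H.dep hdm (H.abs_degKernel_le hε)
      (fun i y => by rw [(H.mpX i).map_eq]; exact H.integral_degKernel_left hε y)
      (fun j x => by rw [(H.mpY j).map_eq]; exact H.integral_degKernel_right hε x) n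
    simp only [hD, mul_pow]
    rw [integral_const_mul]
    refine (mul_le_mul_of_nonneg_left h (by positivity)).trans (le_of_eq ?_)
    field_simp
    ring
  have hT2 : ∫ ω, T ω ^ 2 ∂μ ≤ (2 * m + 1) * (smoothErr pX pY ε / n) := by
    have h := integral_sum_sq_le (μ := μ) (H.memLp_smoothRem hε)
      (H.integral_smoothRem_sq_le hε) (m := m)
      (fun i j hij => H.integral_mul_eq_zero (H.measurable_smoothRem ε)
        (H.integral_smoothRem hε) hij) n
    simp only [hT, mul_pow]
    rw [integral_const_mul]
    refine (mul_le_mul_of_nonneg_left h (by positivity)).trans (le_of_eq ?_)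
    field_simp
  -- The projections cancel against `T` and `linPart`, and of the bias terms exactly one copy
  -- survives.
  refine ⟨fun ω => D ω + T ω + bias pX pY ε, (hDL.add hTL).add (memLp_const _), fun ω => ?_, ?_⟩
  · simp only [hD, hT, degKernel, smoothRem, linPart, Qtwo, Finset.sum_add_distrib,
      Finset.sum_sub_distrib, Finset.sum_const, Finset.card_range, nsmul_eq_mul, ← Finset.sum_div,
      ← Finset.mul_sum]
    field_simp
    ring
  · refine (integral_add_add_sq_le hDL hTL (memLp_const _)).trans ?_
    simp only [integral_const, probReal_univ, one_smul]
    gcongr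

/-- The statistics `F n` are sums of linear parts `S n` with asymptotic variance `4 * σ / n` and
remainders controlled by the bias `β`, the volumes `b` and a term of order `o(1 / n)`. -/
def HasExpansion (μ : Measure Ω) (F : ℕ → Ω → ℝ) (σ : ℝ) (β b : ℕ → ℝ) : Prop :=
  ∃ (S R : ℕ → Ω → ℝ) (δ : ℕ → ℝ) (C : ℝ), (∀ n, MemLp (S n) 2 μ) ∧
    Tendsto (fun n : ℕ => (n : ℝ) * ∫ ω, S n ω ^ 2 ∂μ) atTop (𝓝 (4 * σ)) ∧
    Tendsto δ atTop (𝓝 0) ∧ (∀ n, 0 ≤ δ n) ∧ 0 ≤ C ∧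
    ∀ᶠ n : ℕ in atTop, MemLp (R n) 2 μ ∧ (∀ ω, F n ω = S n ω + R n ω) ∧
      ∫ ω, R n ω ^ 2 ∂μ ≤ C * (1 / (n * b n) ^ 2 + δ n / n + β n ^ 2)

theorem smoothErr_nonneg (pX pY : Rd d → ℝ) (ε : ℝ) : 0 ≤ smoothErr pX pY ε := by
  have h1 : 0 ≤ ∫ x, (smooth ε pY x - pY x) ^ 2 ∂law pX := integral_nonneg fun x => sq_nonneg _
  have h2 : 0 ≤ ∫ x, (smooth ε pX x - pX x) ^ 2 ∂law pY := integral_nonneg fun x => sq_nonneg _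
  unfold smoothErr
  positivity

theorem Sample.hasExpansion_Qtwo (H : Sample μ m X Y pX pY) {ε : ℕ → ℝ}
    (hεpos : ∀ n, 1 ≤ n → 0 < ε n) (hε0 : Tendsto ε atTop (𝓝 0)) :
    HasExpansion μ
      (fun n ω => Qtwo X Y n (ε n) ω / ballVol d (ε n) - ∫ x, pX x * pY x)
      (longRunVar μ m (fun i ω => (1 / 2 : ℝ) * (pY (X i ω) + pX (Y i ω))))
      (fun n => bias pX pY (ε n)) (fun n => ballVol d (ε n)) := by
  have hε : Tendsto ε atTop (𝓝[>] 0) :=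
    tendsto_nhdsWithin_iff.2 ⟨hε0, (eventually_ge_atTop 1).mono fun n hn => hεpos n hn⟩
  choose! R hRL hRF hR2 using fun (n : ℕ) (hn : 1 ≤ n) => H.exists_remainder hn (hεpos n hn)
  -- The constant is `3 * 12 * (4 * m + 1) ^ 2`, from the degenerate term; it dominates the other
  -- two coefficients `3 * (2 * m + 1)` and `3`.
  refine ⟨linPart X Y pX pY, R, fun n => smoothErr pX pY (ε n), 36 * (4 * m + 1) ^ 2,
    H.memLp_linPart, H.tendsto_mul_integral_linPart_sq, H.tendsto_smoothErr.comp hε,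
    fun n => smoothErr_nonneg _ _ _, by positivity, ?_⟩
  filter_upwards [eventually_ge_atTop 1] with n hn
  refine ⟨hRL n hn, hRF n hn, (hR2 n hn).trans ?_⟩
  have hm : (0 : ℝ) ≤ m := by positivity
  have hs : 0 ≤ smoothErr pX pY (ε n) / n := div_nonneg (smoothErr_nonneg _ _ _) (by positivity)
  have hb := sq_nonneg (bias pX pY (ε n))
  have c1 : 3 * (2 * (m : ℝ) + 1) ≤ 36 * (4 * m + 1) ^ 2 := by nlinarith
  have c2 : 3 ≤ 36 * (4 * (m : ℝ) + 1) ^ 2 := by nlinarith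
  have d1 := mul_le_mul_of_nonneg_right c1 hs
  have d2 := mul_le_mul_of_nonneg_right c2 hb
  linarith

theorem Sample.hasExpansion_Qone (H : Sample μ m X X p p) {ε : ℕ → ℝ} (hd : 1 ≤ d)
    (hεpos : ∀ n, 1 ≤ n → 0 < ε n) (hε0 : Tendsto ε atTop (𝓝 0)) :
    HasExpansion μ
      (fun n ω => Qone X n (ε n) ω / ballVol d (ε n) - ∫ x, p x * p x)
      (longRunVar μ m (fun i ω => p (X i ω)))
      (fun n => bias p p (ε n)) (fun n => ballVol d (ε n)) := by
  obtain ⟨S, R, δ, C, hS, hlim, hδ, hδ0, hC, hR⟩ := H.hasExpansion_Qtwo hεpos hε0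
  have hσ : (fun i ω => (1 / 2 : ℝ) * (p (X i ω) + p (X i ω))) = fun i ω => p (X i ω) := by
    ext i ω; ring
  rw [hσ] at hlim
  set q := ∫ x, p x * p x with hq
  set M := |4 * longRunVar μ m (fun i ω => p (X i ω))| + 1
  have hM : ∀ᶠ n : ℕ in atTop, (n : ℝ) * ∫ ω, S n ω ^ 2 ∂μ ≤ M :=
    (hlim.eventually_lt_const (lt_of_le_of_lt (le_abs_self _) (lt_add_one _))).mono
      fun n hn => hn.le
  have hM0 : 0 ≤ M := by positivity
  -- Once the volume is at most one, `1 / n ≤ 1 / (n * b)`, so every correction from the diagonal is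
  -- absorbed by the term `1 / (n * b) ^ 2`. Here `1 ≤ d` makes the volume tend to zero.
  have hb1 : ∀ᶠ n : ℕ in atTop, ballVol d (ε n) ≤ 1 := by
    obtain ⟨v, hv, h⟩ := exists_ballVol_eq d
    have ht : Tendsto (fun n => v * ε n ^ d) atTop (𝓝 0) := by
      have := (hε0.pow d).const_mul v
      simpa [Nat.one_le_iff_ne_zero.1 hd] using this
    filter_upwards [ht.eventually_le_const one_pos, eventually_ge_atTop 1] with n hn hn1
    rwa [h _ (hεpos n hn1).le]
  -- Substituting `Qtwo = b * (S + R + q)` into `Qone_eq` and subtracting `S` leaves exactly this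
  -- remainder.
  refine ⟨S, fun n ω => (n / (n - 1) : ℝ) * R n ω + (1 / (n - 1) : ℝ) * S n ω +
    (q / (n - 1) - 1 / ((n - 1) * ballVol d (ε n))), δ, 12 * C + (12 * M + 24 * q ^ 2 + 24), hS,
    hlim, hδ, hδ0, by positivity, ?_⟩
  filter_upwards [hR, hM, hb1, eventually_ge_atTop 2] with n ⟨hRL, hF, hR2⟩ hMn hbn hn
  have hn1 : (2 : ℝ) ≤ n := by exact_mod_cast hn
  have hn2 : (0 : ℝ) < n - 1 := by linarith
  have hn3 : (0 : ℝ) < n := by linarith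
  have hε := hεpos n (by omega)
  have hb := ballVol_pos (d := d) hε
  set b := ballVol d (ε n)
  have hRL' := hRL.const_mul (n / (n - 1) : ℝ)
  have hSL' := (hS n).const_mul (1 / (n - 1) : ℝ)
  refine ⟨(hRL'.add hSL').add (memLp_const _), fun ω => ?_, ?_⟩
  · have h := hF ω
    rw [Qone_eq X hn hε.le]
    have h2 : Qtwo X X n (ε n) ω = b * (S n ω + R n ω + q) := by
      rw [← h]; field_simp; ring
    rw [h2]
    field_simp
    ring
  · refine (integral_add_add_sq_le hRL' hSL' (memLp_const _)).trans ?_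
    simp only [mul_pow, integral_const_mul, integral_const, probReal_univ, one_smul]
    have f1 : (n / (n - 1) : ℝ) ≤ 2 := by rw [div_le_iff₀ hn2]; linarith
    have f2 : (1 / (n - 1) : ℝ) ≤ 2 / n := by rw [div_le_div_iff₀ hn2 hn3]; linarith
    have f3 : (1 / (n : ℝ)) ≤ 1 / (n * b) :=
      one_div_le_one_div_of_le (by positivity) (mul_le_of_le_one_right hn3.le hbn)
    set z := 1 / (n * b) with hz
    have hz0 : 0 < z := by positivity
    have hs0 : 0 ≤ ∫ ω, S n ω ^ 2 ∂μ := integral_nonneg fun ω => sq_nonneg _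
    have hr0 : 0 ≤ ∫ ω, R n ω ^ 2 ∂μ := integral_nonneg fun ω => sq_nonneg _
    have hsM : ∫ ω, S n ω ^ 2 ∂μ ≤ M := by nlinarith
    have g0 : (1 / (n - 1) : ℝ) ≤ 2 * z := by
      refine f2.trans ?_
      rw [div_eq_mul_one_div]
      linarith
    have g1 : (n / (n - 1) : ℝ) ^ 2 * ∫ ω, R n ω ^ 2 ∂μ ≤ 4 * ∫ ω, R n ω ^ 2 ∂μ := by
      gcongr
      nlinarith [div_nonneg hn3.le hn2.le]
    have g2 : (1 / (n - 1) : ℝ) ^ 2 * ∫ ω, S n ω ^ 2 ∂μ ≤ (2 * z) ^ 2 * M := by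
      gcongr
    have g3 : (q / (n - 1) - 1 / ((n - 1) * b)) ^ 2 ≤ 8 * q ^ 2 * z ^ 2 + 8 * z ^ 2 := by
      have e1 : (q / (n - 1)) ^ 2 ≤ q ^ 2 * (2 * z) ^ 2 := by
        rw [div_eq_mul_one_div, mul_pow]
        gcongr
      have e2 : (1 / ((n - 1) * b)) ^ 2 ≤ (2 * z) ^ 2 := by
        gcongr
        rw [hz, ← mul_div_assoc, div_le_div_iff₀ (by positivity) (by positivity)]
        nlinarith
      nlinarith [sq_nonneg (q / (n - 1) + 1 / ((n - 1) * b))]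
    have hzz : 1 / (n * b) ^ 2 = z ^ 2 := by rw [hz, div_pow, one_pow]
    rw [hzz] at hR2
    rw [← mul_pow, hzz]
    have hδn := hδ0 n
    have hnn : 0 ≤ (12 * M + 24 * q ^ 2 + 24) * (δ n / n + bias p p (ε n) ^ 2) := by positivity
    linarith

end MeanSquare

/-! ### From the expansion to mean square errors -/

section Rates

variable {Ω : Type*} [MeasurableSpace Ω] {d : ℕ} {μ : Measure Ω}

/-- Young's inequality `2 * |a * b| ≤ t * a ^ 2 + b ^ 2 / t`; the free weight `t` allows the cross
term to be balanced. -/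
theorem abs_integral_add_sq_sub_le {f g : Ω → ℝ} (hf : MemLp f 2 μ) (hg : MemLp g 2 μ) {t : ℝ}
    (ht : 0 < t) : |∫ ω, (f ω + g ω) ^ 2 ∂μ - ∫ ω, f ω ^ 2 ∂μ| ≤
      t * ∫ ω, f ω ^ 2 ∂μ + (1 + 1 / t) * ∫ ω, g ω ^ 2 ∂μ := by
  have hfg : Integrable (fun ω => (f ω + g ω) ^ 2) μ := (hf.add hg).integrable_sq
  rw [← integral_sub hfg hf.integrable_sq, ← integral_const_mul,
    ← integral_const_mul, ← integral_add (hf.integrable_sq.const_mul _)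
      (hg.integrable_sq.const_mul _)]
  refine abs_integral_le_integral_abs.trans (integral_mono
    (hfg.sub hf.integrable_sq).abs
    ((hf.integrable_sq.const_mul _).add (hg.integrable_sq.const_mul _)) fun ω => ?_)
  simp only
  set a := f ω
  set b := g ω
  have h1 : 0 ≤ t * a ^ 2 + 2 * (a * b) + 1 / t * b ^ 2 := by
    have : t * a ^ 2 + 2 * (a * b) + 1 / t * b ^ 2 = (t * a + b) ^ 2 / t := by field_simp; ring
    rw [this]; positivity
  have h2 : 0 ≤ t * a ^ 2 - 2 * (a * b) + 1 / t * b ^ 2 := by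
    have : t * a ^ 2 - 2 * (a * b) + 1 / t * b ^ 2 = (t * a - b) ^ 2 / t := by field_simp; ring
    rw [this]; positivity
  rw [abs_le]
  constructor <;> nlinarith [sq_nonneg b]

theorem HasExpansion.exists_integral_sq_le {F : ℕ → Ω → ℝ} {σ : ℝ} {β b : ℕ → ℝ}
    (h : HasExpansion μ F σ β b) : ∃ C : ℝ, 0 ≤ C ∧ ∀ᶠ n : ℕ in atTop,
      ∫ ω, F n ω ^ 2 ∂μ ≤ C * (1 / (n * b n) ^ 2 + 1 / n + β n ^ 2) := by
  obtain ⟨S, R, δ, C, hS, hlim, hδ, hδ0, hC, hR⟩ := h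
  set M := |4 * σ| + 1
  have hM0 : 0 ≤ M := by positivity
  refine ⟨2 * M + 2 * C, by positivity, ?_⟩
  filter_upwards [hR, hlim.eventually_le_const (lt_of_le_of_lt (le_abs_self _) (lt_add_one _)),
    hδ.eventually_le_const one_pos, eventually_ge_atTop 1] with n ⟨hRL, hF, hR2⟩ hMn hδn hn
  have hn0 : (0 : ℝ) < n := by positivity
  have h1 := (abs_le.1 (abs_integral_add_sq_sub_le (hS n) hRL one_pos)).2
  simp_rw [hF]
  have h2 : ∫ ω, S n ω ^ 2 ∂μ ≤ M * (1 / n) := by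
    rw [mul_one_div, le_div_iff₀ hn0, mul_comm]
    exact hMn
  have h3 : δ n / n ≤ 1 / n := by gcongr
  have h4 : C * (1 / (n * b n) ^ 2 + δ n / n + β n ^ 2) ≤
      C * (1 / (n * b n) ^ 2 + 1 / n + β n ^ 2) := by gcongr
  have h5 : 0 ≤ M * (1 / (n * b n) ^ 2 + β n ^ 2) := by positivity
  linarith

theorem HasExpansion.isLittleO {F : ℕ → Ω → ℝ} {σ : ℝ} {β b : ℕ → ℝ}
    (h : HasExpansion μ F σ β b) (hβ : Tendsto (fun n : ℕ => (n : ℝ) * β n ^ 2) atTop (𝓝 0))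
    (hb : Tendsto (fun n : ℕ => (n : ℝ) * (1 / (n * b n) ^ 2)) atTop (𝓝 0)) :
    (fun n : ℕ => ∫ ω, F n ω ^ 2 ∂μ - 4 * σ / n) =o[atTop] (fun n : ℕ => 1 / (n : ℝ)) := by
  obtain ⟨S, R, δ, C, hS, hlim, hδ, hδ0, hC, hR⟩ := h
  -- `w n` bounds `n * E R ^ 2`. The added `1 / n` keeps it positive, so the Young weight `t = √(w
  -- n)` is admissible; both error terms then tend to zero.
  set w : ℕ → ℝ := fun n => C * (n * (1 / (n * b n) ^ 2) + δ n + n * β n ^ 2) + 1 / n with hw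
  have hw0 : Tendsto w atTop (𝓝 0) := by
    have := (((hb.add hδ).add hβ).const_mul C).add tendsto_one_div_atTop_nhds_zero_nat
    simpa [hw] using this
  have hsq : Tendsto (fun n => Real.sqrt (w n)) atTop (𝓝 0) := by
    simpa using hw0.sqrt
  have hbound : Tendsto (fun n : ℕ => Real.sqrt (w n) * ((n : ℝ) * ∫ ω, S n ω ^ 2 ∂μ) +
      (w n + Real.sqrt (w n))) atTop (𝓝 0) := by
    simpa using (hsq.mul hlim).add (hw0.add hsq)
  have hdiff : Tendsto (fun n : ℕ => (n : ℝ) * ∫ ω, F n ω ^ 2 ∂μ -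
      (n : ℝ) * ∫ ω, S n ω ^ 2 ∂μ) atTop (𝓝 0) := by
    refine squeeze_zero_norm' ?_ hbound
    filter_upwards [hR, eventually_ge_atTop 1] with n ⟨hRL, hF, hR2⟩ hn
    have hn0 : (0 : ℝ) < n := by positivity
    have hδn := hδ0 n
    have hwn : 0 < w n := by simp only [hw]; positivity
    have hs := Real.sqrt_pos.2 hwn
    have h1 := abs_integral_add_sq_sub_le (hS n) hRL hs
    have h2 : (n : ℝ) * ∫ ω, R n ω ^ 2 ∂μ ≤ w n := by
      have h3 := mul_le_mul_of_nonneg_left hR2 hn0.le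
      have h4 : (n : ℝ) * (C * (1 / (n * b n) ^ 2 + δ n / n + β n ^ 2)) =
          C * (n * (1 / (n * b n) ^ 2) + δ n + n * β n ^ 2) := by
        rw [show δ n = n * (δ n / n) by field_simp]
        rw [show (n : ℝ) * (δ n / n) / n = δ n / n by field_simp]
        ring
      have h5 : 0 ≤ 1 / (n : ℝ) := by positivity
      simp only [hw]
      linarith
    simp_rw [hF]
    rw [← mul_sub, Real.norm_eq_abs, abs_mul, abs_of_pos hn0]
    have h6 : (1 + 1 / Real.sqrt (w n)) * w n = w n + Real.sqrt (w n) := by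
      rw [add_mul, one_mul, one_div_mul_eq_div, Real.div_sqrt]
    calc _ ≤ (n : ℝ) * (Real.sqrt (w n) * ∫ ω, S n ω ^ 2 ∂μ +
          (1 + 1 / Real.sqrt (w n)) * ∫ ω, R n ω ^ 2 ∂μ) := by gcongr
      _ = Real.sqrt (w n) * ((n : ℝ) * ∫ ω, S n ω ^ 2 ∂μ) +
          (1 + 1 / Real.sqrt (w n)) * ((n : ℝ) * ∫ ω, R n ω ^ 2 ∂μ) := by ring
      _ ≤ Real.sqrt (w n) * ((n : ℝ) * ∫ ω, S n ω ^ 2 ∂μ) +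
          (1 + 1 / Real.sqrt (w n)) * w n := by gcongr
      _ = _ := by rw [h6]
  have hfin := hdiff.add (hlim.sub_const (4 * σ))
  rw [sub_self, add_zero] at hfin
  rw [isLittleO_iff_tendsto' ((eventually_ge_atTop 1).mono fun n hn h0 => by
    have : (0 : ℝ) < 1 / n := by positivity
    linarith)]
  refine hfin.congr' ?_
  filter_upwards [eventually_ge_atTop 1] with n hn
  have hn0 : (0 : ℝ) < n := by positivity
  field_simp
  ring

end Rates

/-! ### Consequences of the choice of bandwidth -/

section Bandwidth

variable {d : ℕ} {ε : ℕ → ℝ}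

theorem eventually_mul_le_and_le_mul {f g : ℕ → ℝ} (h : f ~[atTop] g)
    (hg : ∀ᶠ n in atTop, 0 < g n) :
    ∀ᶠ n in atTop, 1 / 2 * g n ≤ f n ∧ f n ≤ 2 * g n := by
  have := h.isLittleO.def (c := 1 / 2) (by norm_num)
  filter_upwards [this, hg] with n hn hg
  simp only [Pi.sub_apply, Real.norm_eq_abs] at hn
  rw [abs_of_pos hg, abs_le] at hn
  constructor <;> linarith [hn.1, hn.2]

theorem tendsto_ballVol_mul_atTop (hεpos : ∀ n, 1 ≤ n → 0 < ε n)
    (h : Tendsto (fun n : ℕ => (n : ℝ) * ε n ^ d) atTop atTop) :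
    Tendsto (fun n : ℕ => (n : ℝ) * ballVol d (ε n)) atTop atTop := by
  obtain ⟨v, hv, hb⟩ := exists_ballVol_eq d
  refine (h.const_mul_atTop hv).congr' ?_
  filter_upwards [eventually_ge_atTop 1] with n hn
  rw [hb _ (hεpos n hn).le]
  ring

theorem isBigO_one_div_mul_ballVol_sq {α c : ℝ} (hα : 0 < α) (hc : 0 < c)
    (hεpos : ∀ n, 1 ≤ n → 0 < ε n)
    (hε : ε ~[atTop] (fun n : ℕ => c * (n : ℝ) ^ (-(1 / (2 * α + (d : ℝ)))))) :
    (fun n : ℕ => 1 / ((n : ℝ) * ballVol d (ε n)) ^ 2) =O[atTop]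
      (fun n : ℕ => (n : ℝ) ^ (-(4 * α / (2 * α + (d : ℝ))))) := by
  obtain ⟨v, hv, hb⟩ := exists_ballVol_eq d
  have hpos : ∀ᶠ n : ℕ in atTop, 0 < c * (n : ℝ) ^ (-(1 / (2 * α + (d : ℝ)))) :=
    (eventually_ge_atTop 1).mono fun n hn => by positivity
  have hden : 0 < 2 * α + (d : ℝ) := by positivity
  refine IsBigO.of_bound (1 / (v * (1 / 2 * c) ^ d) ^ 2) ?_
  filter_upwards [eventually_mul_le_and_le_mul hε hpos, eventually_ge_atTop 1] with n hn hn1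
  have hn0 : (0 : ℝ) < n := by positivity
  have hp := hεpos n hn1
  rw [hb _ hp.le, Real.norm_of_nonneg (by positivity), Real.norm_of_nonneg (by positivity)]
  set N := (n : ℝ) ^ (-(1 / (2 * α + (d : ℝ)))) with hN
  have hN0 : 0 < N := by positivity
  have e : 1 / ((n : ℝ) * N ^ d) ^ 2 = (n : ℝ) ^ (-(4 * α / (2 * α + (d : ℝ)))) := by
    have e1 : (n : ℝ) * N ^ d = (n : ℝ) ^ (2 * α / (2 * α + (d : ℝ))) := by
      rw [hN, ← Real.rpow_mul_natCast hn0.le]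
      nth_rewrite 1 [← Real.rpow_one (n : ℝ)]
      rw [← Real.rpow_add hn0]
      congr 1
      field_simp
      ring
    rw [e1, ← Real.rpow_mul_natCast hn0.le, one_div, ← Real.rpow_neg hn0.le]
    congr 1
    push_cast
    ring
  rw [← e, one_div_mul_one_div, ← mul_pow]
  have h1 : v * (1 / 2 * c) ^ d * (n * N ^ d) = n * (v * (1 / 2 * (c * N)) ^ d) := by
    rw [← mul_assoc (1 / 2 : ℝ), mul_pow (1 / 2 * c) N]; ring
  rw [h1]
  have h2 := hn.1
  gcongr

theorem isBigO_bias_sq {α c K : ℝ} (hα : 0 < α) (hc : 0 < c) {β : ℕ → ℝ}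
    (hβ : ∀ᶠ n in atTop, |β n| ≤ (K * ε n ^ α) ^ 2) (hεpos : ∀ n, 1 ≤ n → 0 < ε n)
    (hε : ε ~[atTop] (fun n : ℕ => c * (n : ℝ) ^ (-(1 / (2 * α + (d : ℝ)))))) :
    (fun n : ℕ => β n ^ 2) =O[atTop]
      (fun n : ℕ => (n : ℝ) ^ (-(4 * α / (2 * α + (d : ℝ))))) := by
  have hpos : ∀ᶠ n : ℕ in atTop, 0 < c * (n : ℝ) ^ (-(1 / (2 * α + (d : ℝ)))) :=
    (eventually_ge_atTop 1).mono fun n hn => by positivity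
  refine IsBigO.of_bound ((K * (2 * c) ^ α) ^ 4) ?_
  filter_upwards [eventually_mul_le_and_le_mul hε hpos, eventually_ge_atTop 1, hβ] with n hn hn1 hb
  have hn0 : (0 : ℝ) < n := by positivity
  have hp := hεpos n hn1
  rw [Real.norm_of_nonneg (by positivity), Real.norm_of_nonneg (by positivity), ← sq_abs]
  have e : ((2 * (c * (n : ℝ) ^ (-(1 / (2 * α + (d : ℝ)))))) ^ α) ^ 4 =
      ((2 * c) ^ α) ^ 4 * (n : ℝ) ^ (-(4 * α / (2 * α + (d : ℝ)))) := by
    rw [← mul_assoc, Real.mul_rpow (by positivity) (by positivity), mul_pow,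
      ← Real.rpow_mul hn0.le, ← Real.rpow_mul_natCast hn0.le]
    congr 2
    push_cast
    ring
  calc |β n| ^ 2 ≤ ((K * ε n ^ α) ^ 2) ^ 2 := by gcongr
    _ = K ^ 4 * (ε n ^ α) ^ 4 := by ring
    _ ≤ K ^ 4 * ((2 * (c * (n : ℝ) ^ (-(1 / (2 * α + (d : ℝ)))))) ^ α) ^ 4 := by
        have := hn.2
        gcongr
    _ = _ := by rw [e]; ring

theorem tendsto_mul_bias_sq {α K : ℝ} {L : ℝ → ℝ} (hα : 1 / 2 < α) {β : ℕ → ℝ}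
    (hβ : ∀ᶠ n in atTop, |β n| ≤ (K * ε n ^ α) ^ 2) (hεpos : ∀ n, 1 ≤ n → 0 < ε n)
    (hL : SlowlyVarying L)
    (hε : ε ~[atTop] (fun n : ℕ => L (n : ℝ) * (n : ℝ) ^ (-(1 / 2 : ℝ)))) :
    Tendsto (fun n : ℕ => (n : ℝ) * β n ^ 2) atTop (𝓝 0) := by
  have hα0 : 0 < α := by linarith
  -- This exponent makes `L ^ (4 * α)` cost `n ^ ((2 * α - 1) / 2)`, half of the available decay `n
  -- ^ (1 - 2 * α)`.
  obtain ⟨C, hC, hLC⟩ := hL.eventually_le_rpow (δ := (2 * α - 1) / (8 * α))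
    (div_pos (by linarith) (by linarith))
  have hpos : ∀ᶠ n : ℕ in atTop, 0 < L (n : ℝ) * (n : ℝ) ^ (-(1 / 2 : ℝ)) := by
    filter_upwards [tendsto_natCast_atTop_atTop.eventually hL.2.1, eventually_ge_atTop 1]
      with n hn hn1
    have : (0 : ℝ) < n := by positivity
    positivity
  have hlim : Tendsto (fun n : ℕ => K ^ 4 * ((2 * C) ^ α) ^ 4 *
      (n : ℝ) ^ (-((2 * α - 1) / 2))) atTop (𝓝 0) := by
    have := (tendsto_rpow_neg_atTop (y := (2 * α - 1) / 2) (by linarith)).comp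
      (tendsto_natCast_atTop_atTop (R := ℝ))
    simpa using this.const_mul (K ^ 4 * ((2 * C) ^ α) ^ 4)
  refine squeeze_zero' ((eventually_ge_atTop 1).mono fun n hn => by positivity) ?_ hlim
  filter_upwards [eventually_mul_le_and_le_mul hε hpos, eventually_ge_atTop 1, hβ,
    tendsto_natCast_atTop_atTop.eventually hLC] with n hn hn1 hb hLn
  have hn0 : (0 : ℝ) < n := by positivity
  have hp := hεpos n hn1
  have hle : ε n ≤ 2 * C * (n : ℝ) ^ ((2 * α - 1) / (8 * α) - 1 / 2) := by
    rw [sub_eq_add_neg, Real.rpow_add hn0]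
    refine hn.2.trans ?_
    rw [mul_assoc 2 C, ← mul_assoc C]
    gcongr
  have e : (n : ℝ) * ((2 * C * (n : ℝ) ^ ((2 * α - 1) / (8 * α) - 1 / 2)) ^ α) ^ 4 =
      ((2 * C) ^ α) ^ 4 * (n : ℝ) ^ (-((2 * α - 1) / 2)) := by
    rw [Real.mul_rpow (by positivity) (by positivity), mul_pow,
      ← Real.rpow_mul hn0.le, ← Real.rpow_mul_natCast hn0.le, mul_left_comm]
    congr 1
    nth_rewrite 1 [← Real.rpow_one (n : ℝ)]
    rw [← Real.rpow_add hn0]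
    congr 1
    push_cast
    field_simp
    ring
  calc (n : ℝ) * β n ^ 2 = n * |β n| ^ 2 := by rw [sq_abs]
    _ ≤ n * ((K * ε n ^ α) ^ 2) ^ 2 := by gcongr
    _ = K ^ 4 * (n * (ε n ^ α) ^ 4) := by ring
    _ ≤ K ^ 4 * (n * ((2 * C * (n : ℝ) ^ ((2 * α - 1) / (8 * α) - 1 / 2)) ^ α) ^ 4) := by gcongr
    _ = _ := by rw [e]; ring

/-- In dimension one the quantity is of order `1 / (n * ε ^ 2)`, that is `1 / L ^ 2`, which vanishes
because `L` diverges. -/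
theorem tendsto_mul_one_div_sq {L : ℝ → ℝ} (hd : d = 1) (hεpos : ∀ n, 1 ≤ n → 0 < ε n)
    (hL : Tendsto (fun n : ℕ => L (n : ℝ)) atTop atTop)
    (hε : ε ~[atTop] (fun n : ℕ => L (n : ℝ) * (n : ℝ) ^ (-(1 / 2 : ℝ)))) :
    Tendsto (fun n : ℕ => (n : ℝ) * (1 / (n * ballVol d (ε n)) ^ 2)) atTop (𝓝 0) := by
  obtain ⟨v, hv, hb⟩ := exists_ballVol_eq d
  have hpos : ∀ᶠ n : ℕ in atTop, 0 < L (n : ℝ) * (n : ℝ) ^ (-(1 / 2 : ℝ)) := by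
    filter_upwards [hL.eventually_gt_atTop 0, eventually_ge_atTop 1] with n hn hn1
    have : (0 : ℝ) < n := by positivity
    positivity
  have hlim : Tendsto (fun n : ℕ => ((v * (1 / 2)) ^ 2 * (L (n : ℝ)) ^ 2)⁻¹) atTop (𝓝 0) :=
    tendsto_inv_atTop_zero.comp
      (((tendsto_pow_atTop two_ne_zero).comp hL).const_mul_atTop (by positivity))
  refine squeeze_zero' ((eventually_ge_atTop 1).mono fun n hn => by positivity) ?_ hlim
  filter_upwards [eventually_mul_le_and_le_mul hε hpos, eventually_ge_atTop 1,
    hL.eventually_gt_atTop 0] with n hn hn1 hLn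
  have hn0 : (0 : ℝ) < n := by positivity
  have hp := hεpos n hn1
  rw [hb _ hp.le, hd, pow_one]
  have e1 : (n : ℝ) * (1 / (n * (v * ε n)) ^ 2) = (v ^ 2 * (n * ε n ^ 2))⁻¹ := by field_simp
  have e2 : L (n : ℝ) ^ 2 = n * (L (n : ℝ) * (n : ℝ) ^ (-(1 / 2 : ℝ))) ^ 2 := by
    rw [mul_pow, ← Real.rpow_mul_natCast hn0.le]
    norm_num
    rw [Real.rpow_neg_one]
    field_simp
  rw [e1, e2]
  refine inv_anti₀ (by positivity) ?_
  have h1 : (1 / 2 * (L (n : ℝ) * (n : ℝ) ^ (-(1 / 2 : ℝ)))) ^ 2 ≤ ε n ^ 2 :=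
    pow_le_pow_left₀ (by positivity) hn.1 2
  calc _ = v ^ 2 * (n * (1 / 2 * (L (n : ℝ) * (n : ℝ) ^ (-(1 / 2 : ℝ)))) ^ 2) := by ring
    _ ≤ _ := by gcongr

variable {Ω : Type*} [MeasurableSpace Ω] {μ : Measure Ω} {F : ℕ → Ω → ℝ} {σ : ℝ} {β : ℕ → ℝ}

theorem HasExpansion.tendsto_integral_sq
    (h : HasExpansion μ F σ β (fun n => ballVol d (ε n)))
    (hβ : Tendsto (fun n => β n ^ 2) atTop (𝓝 0)) (hεpos : ∀ n, 1 ≤ n → 0 < ε n)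
    (hn : Tendsto (fun n : ℕ => (n : ℝ) * ε n ^ d) atTop atTop) :
    Tendsto (fun n => ∫ ω, F n ω ^ 2 ∂μ) atTop (𝓝 0) := by
  obtain ⟨C, hC, hle⟩ := h.exists_integral_sq_le
  have h1 : Tendsto (fun n : ℕ => 1 / ((n : ℝ) * ballVol d (ε n)) ^ 2) atTop (𝓝 0) := by
    simp_rw [one_div]
    exact tendsto_inv_atTop_zero.comp
      ((tendsto_pow_atTop two_ne_zero).comp (tendsto_ballVol_mul_atTop hεpos hn))
  have h2 := ((h1.add tendsto_one_div_atTop_nhds_zero_nat).add hβ).const_mul C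
  simp only [add_zero, mul_zero] at h2
  exact squeeze_zero' (Eventually.of_forall fun n => integral_nonneg fun ω => sq_nonneg _) hle h2

/-- This bandwidth balances the degenerate term against the squared bias; `α ≤ d / 2` is what keeps
the linear term `1 / n` within the same rate. -/
theorem HasExpansion.isBigO_integral_sq {α c K : ℝ}
    (h : HasExpansion μ F σ β (fun n => ballVol d (ε n)))
    (hβ : ∀ᶠ n in atTop, |β n| ≤ (K * ε n ^ α) ^ 2) (hεpos : ∀ n, 1 ≤ n → 0 < ε n)
    (hα : 0 < α) (hαd : α ≤ (d : ℝ) / 2) (hc : 0 < c)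
    (hε : ε ~[atTop] (fun n : ℕ => c * (n : ℝ) ^ (-(1 / (2 * α + (d : ℝ)))))) :
    (fun n => ∫ ω, F n ω ^ 2 ∂μ) =O[atTop]
      (fun n : ℕ => (n : ℝ) ^ (-(4 * α / (2 * α + (d : ℝ))))) := by
  obtain ⟨C, hC, hle⟩ := h.exists_integral_sq_le
  have h1 : (fun n : ℕ => 1 / (n : ℝ)) =O[atTop]
      (fun n : ℕ => (n : ℝ) ^ (-(4 * α / (2 * α + (d : ℝ))))) := by
    refine IsBigO.of_bound 1 ?_
    filter_upwards [eventually_ge_atTop 1] with n hn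
    have hn1 : (1 : ℝ) ≤ n := by exact_mod_cast hn
    rw [Real.norm_of_nonneg (by positivity), Real.norm_of_nonneg (by positivity), one_mul,
      one_div, ← Real.rpow_neg_one]
    refine Real.rpow_le_rpow_of_exponent_le hn1 ?_
    have hden : 0 < 2 * α + (d : ℝ) := by positivity
    rw [neg_le_neg_iff, div_le_one hden]
    linarith
  refine IsBigO.trans (IsBigO.of_bound 1 ?_)
    ((((isBigO_one_div_mul_ballVol_sq hα hc hεpos hε).add h1).add
      (isBigO_bias_sq hα hc hβ hεpos hε)).const_mul_left C)
  filter_upwards [hle] with n hn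
  rw [Real.norm_of_nonneg (integral_nonneg fun ω => sq_nonneg _), one_mul]
  exact hn.trans (le_abs_self _)

theorem HasExpansion.isLittleO_of_slowlyVarying {α K : ℝ} {L : ℝ → ℝ}
    (h : HasExpansion μ F σ β (fun n => ballVol d (ε n)))
    (hβ : ∀ᶠ n in atTop, |β n| ≤ (K * ε n ^ α) ^ 2) (hεpos : ∀ n, 1 ≤ n → 0 < ε n)
    (hd : d = 1) (hα : 1 / 2 < α) (hL : SlowlyVarying L)
    (hLt : Tendsto (fun n : ℕ => L (n : ℝ)) atTop atTop)
    (hε : ε ~[atTop] (fun n : ℕ => L (n : ℝ) * (n : ℝ) ^ (-(1 / 2 : ℝ)))) :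
    (fun n : ℕ => ∫ ω, F n ω ^ 2 ∂μ - 4 * σ / n) =o[atTop] (fun n : ℕ => 1 / (n : ℝ)) :=
  h.isLittleO (tendsto_mul_bias_sq hα hβ hεpos hL hε) (tendsto_mul_one_div_sq hd hεpos hLt hε)

theorem Sample.tendsto_bias_sq_comp [IsProbabilityMeasure μ] {m : ℕ} {X Y : ℕ → Ω → Rd d}
    {pX pY : Rd d → ℝ} (H : Sample μ m X Y pX pY) (hεpos : ∀ n, 1 ≤ n → 0 < ε n)
    (hε0 : Tendsto ε atTop (𝓝 0)) :
    Tendsto (fun n => bias pX pY (ε n) ^ 2) atTop (𝓝 0) :=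
  H.tendsto_bias_sq.comp (tendsto_nhdsWithin_iff.2
    ⟨hε0, (eventually_ge_atTop 1).mono fun n hn => hεpos n hn⟩)

theorem Sample.eventually_abs_bias_le [IsProbabilityMeasure μ] {m : ℕ} {X Y : ℕ → Ω → Rd d}
    {pX pY : Rd d → ℝ} (H : Sample μ m X Y pX pY) (hεpos : ∀ n, 1 ≤ n → 0 < ε n)
    (hε0 : Tendsto ε atTop (𝓝 0)) {α K : ℝ} (hα : 0 < α) (hK : 0 < K) (hX : MemH2 α K pX)
    (hY : MemH2 α K pY) : ∀ᶠ n in atTop, |bias pX pY (ε n)| ≤ (K * ε n ^ α) ^ 2 := by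
  filter_upwards [eventually_ge_atTop 1, hε0.eventually_le_const one_pos] with n hn hn1
  exact abs_integral_smooth_sub_le H.integrableX H.swap.integrableX hα.le hK.le hX hY
    (hεpos n hn) hn1

end Bandwidth

/-! ### The three functionals treated together -/

theorem Sample.exists_hasExpansion {Ω : Type*} [MeasurableSpace Ω] {d : ℕ} {μ : Measure Ω}
    [IsProbabilityMeasure μ] {m : ℕ} {X Y : ℕ → Ω → Rd d} {pX pY : Rd d → ℝ} {ε : ℕ → ℝ}
    (H : Sample μ m X Y pX pY) (hd : 1 ≤ d) (hεpos : ∀ n, 1 ≤ n → 0 < ε n)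
    (hε0 : Tendsto ε atTop (𝓝 0)) {k l : ℕ} (hkl : k + l = 2) :
    ∃ β : ℕ → ℝ, HasExpansion μ (fun n ω => Qtilde k l X Y n (ε n) ω - q k l pX pY)
        (sigmaSq μ m k l X Y pX pY) β (fun n => ballVol d (ε n)) ∧
      Tendsto (fun n => β n ^ 2) atTop (𝓝 0) ∧
      ∀ α K : ℝ, 0 < α → 0 < K → MemH2 α K pX → MemH2 α K pY →
        ∀ᶠ n in atTop, |β n| ≤ (K * ε n ^ α) ^ 2 := by
  obtain ⟨rfl, rfl⟩ | ⟨rfl, rfl⟩ | ⟨rfl, rfl⟩ :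
      (k = 2 ∧ l = 0) ∨ (k = 1 ∧ l = 1) ∨ (k = 0 ∧ l = 2) := by omega
  · refine ⟨fun n => bias pX pX (ε n), ?_, H.diag_left.tendsto_bias_sq_comp hεpos hε0,
      fun α K hα hK hX _ => H.diag_left.eventually_abs_bias_le hεpos hε0 hα hK hX hX⟩
    have e : q 2 0 pX pY = ∫ x, pX x * pX x := by simp [q, sq]
    rw [e]
    exact H.diag_left.hasExpansion_Qone hd hεpos hε0
  · refine ⟨fun n => bias pX pY (ε n), ?_, H.tendsto_bias_sq_comp hεpos hε0,
      fun α K hα hK hX hY => H.eventually_abs_bias_le hεpos hε0 hα hK hX hY⟩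
    have e : q 1 1 pX pY = ∫ x, pX x * pY x := by simp [q]
    rw [e]
    exact H.hasExpansion_Qtwo hεpos hε0
  · refine ⟨fun n => bias pY pY (ε n), ?_, H.swap.diag_left.tendsto_bias_sq_comp hεpos hε0,
      fun α K hα hK _ hY => H.swap.diag_left.eventually_abs_bias_le hεpos hε0 hα hK hY hY⟩
    have e : q 0 2 pX pY = ∫ x, pY x * pY x := by simp [q, sq]
    rw [e]
    exact H.swap.diag_left.hasExpansion_Qone hd hεpos hε0

end QuadDensity

theorem theorem2 {Ω : Type*} [MeasurableSpace Ω] (μ : Measure Ω) [IsProbabilityMeasure μ]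
    (d : ℕ) (hd : 1 ≤ d) (m : ℕ)
    (X Y : ℕ → Ω → QuadDensity.Rd d)
    (hX : ∀ i, Measurable (X i)) (hY : ∀ i, Measurable (Y i))
    (hstat : QuadDensity.StrictlyStationary μ (fun i ω => (X i ω, Y i ω)))
    (hdep : QuadDensity.MDependent μ m (fun i ω => (X i ω, Y i ω)))
    (pX pY : QuadDensity.Rd d → ℝ)
    (hpX : QuadDensity.IsDensity μ (X 0) pX) (hpY : QuadDensity.IsDensity μ (Y 0) pY)
    (hpX3 : MemLp pX 3 volume) (hpY3 : MemLp pY 3 volume)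
    (ε : ℕ → ℝ) (hεpos : ∀ n, 1 ≤ n → 0 < ε n) (hε0 : Tendsto ε atTop (𝓝 0))
    (k l : ℕ) (hkl : k + l = 2) :
    -- (i) mean square consistency
    (Tendsto (fun n : ℕ => (n : ℝ) * ε n ^ d) atTop atTop →
      Tendsto (fun n : ℕ => QuadDensity.mse μ k l X Y pX pY n (ε n)) atTop (𝓝 0)) ∧
    -- (ii) rate for low smoothness
    (∀ α K c : ℝ, 0 < α → α ≤ 1 → α ≤ (d : ℝ) / 2 → 0 < K → 0 < c →
      QuadDensity.MemH2 α K pX → QuadDensity.MemH2 α K pY →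
      ε ~[atTop] (fun n : ℕ => c * (n : ℝ) ^ (-(1 / (2 * α + (d : ℝ))))) →
      (fun n : ℕ => QuadDensity.mse μ k l X Y pX pY n (ε n))
        =O[atTop] (fun n : ℕ => (n : ℝ) ^ (-(4 * α / (2 * α + (d : ℝ)))))) ∧
    -- (iii) exact asymptotics in dimension one
    (d = 1 → ∀ (α K : ℝ) (L : ℝ → ℝ), 1 / 2 < α → α ≤ 1 → 0 < K →
      QuadDensity.MemH2 α K pX → QuadDensity.MemH2 α K pY →
      QuadDensity.SlowlyVarying L → Tendsto (fun n : ℕ => L (n : ℝ)) atTop atTop →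
      ε ~[atTop] (fun n : ℕ => L (n : ℝ) * (n : ℝ) ^ (-(1 / 2 : ℝ))) →
      (fun n : ℕ => QuadDensity.mse μ k l X Y pX pY n (ε n)
          - 4 * QuadDensity.sigmaSq μ m k l X Y pX pY / (n : ℝ))
        =o[atTop] (fun n : ℕ => 1 / (n : ℝ))) := by
  have hs : QuadDensity.Sample μ m X Y pX pY := ⟨hX, hY, hstat, hdep, hpX, hpY, hpX3, hpY3⟩
  obtain ⟨β, hexp, hβ0, hβ⟩ := hs.exists_hasExpansion hd hεpos hε0 hkl
  refine ⟨hexp.tendsto_integral_sq hβ0 hεpos, ?_, ?_⟩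
  · intro α K c hα _ hαd hK hc hHX hHY hε
    exact hexp.isBigO_integral_sq (hβ α K hα hK hHX hHY) hεpos hα hαd hc hε
  · intro hd1 α K L hα _ hK hHX hHY hL hLt hε
    exact hexp.isLittleO_of_slowlyVarying (hβ α K (by linarith) hK hHX hHY) hεpos hd1 hα hL hLt hε
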